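/- All rings are commutative with identity, and fields count as principal ideal domains. Let $R$ be a noetherian ring. A finitely generated $R$-module $C$ is semidualizing if $\operatorname{Hom}_R(C,C)\cong R$ and $\operatorname{Ext}_R^n(C,C)=0$ for all $n\geq 1$. Let $\mathfrak{S}_0(R)$ be the set of isomorphism classes of semidualizing $R$-modules, and for $[C],[M]\in\mathfrak{S}_0(R)$ write $[C]\trianglelefteq[M]$ if $M$ is totally $C$-reflexive, i.e. $M\cong\operatorname{Hom}_R(\operatorname{Hom}_R(M,C),C)$ and $\operatorname{Ext}^n_R(M,C)=0=\operatorname{Ext}^n_R(\operatorname{Hom}_R(M,C),C)$ for all $n\geq 1$. The Picard group $\operatorname{Pic}(R)$ of isomorphism classes of invertible $R$-modules, with operation $[\mathfrak{a}]+[\mathfrak{b}]=[\mathfrak{a}\otimes_R\mathfrak{b}]$, is contained in $\mathfrak{S}_0(R)$ and acts on $\mathfrak{S}_0(R)$ by $[\mathfrak{a}]+[C]=[\mathfrak{a}\otimes_R C]$. Let $\overline{\mathfrak{S}}_0(R)$ be the orbit space of this action, let $\langle C\rangle$ denote the orbit of $[C]$, and write $\langle C\rangle\trianglelefteq\langle M\rangle$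 if $[C]\trianglelefteq[M]$ (this does not depend on the representatives). Products of sets with relations carry the componentwise relation, and a map $f$ is relation-respecting if $u\trianglelefteq v$ implies $f(u)\trianglelefteq f(v)$. **Proposition 3.4.** Let $D$ be a principal ideal domain, let $R_1,R_2$ be noetherian integral domains equipped with ring monomorphisms $D\to R_1$ and $D\to R_2$, and set $T=R_1\otimes_D R_2$. Assume that $T$ is noetherian. Then there is a well-defined, relation-respecting map $\phi\colon\mathfrak{S}_0(R_1)\times\mathfrak{S}_0(R_2)\to\mathfrak{S}_0(T)$ given by $([C_1],[C_2])\mapsto[C_1\otimes_D C_2]$, and the following hold. (a) The map $\phi$ induces (by restriction) a group homomorphism $\psi\colon\operatorname{Pic}(R_1)\times\operatorname{Pic}(R_2)\to\operatorname{Pic}(T)$ with $$\psi([\mathfrak{a}_1],[\mathfrak{a}_2])=[\mathfrak{a}_1\otimes_D\mathfrak{a}_2]=[\mathfrak{a}_1\otimes_{R_1}T]+[T\otimes_{R_2}\mathfrak{a}_2]=[\mathfrak{a}_1\otimes_D R_2]+[R_1\otimes_D\mathfrak{a}_2].$$ (b) The map $\phi$ is equivariant for the componentwise action of $\operatorname{Pic}(R_1)\times\operatorname{Pic}(R_2)$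 on $\mathfrak{S}_0(R_1)\times\mathfrak{S}_0(R_2)$ and the action of $\operatorname{Pic}(T)$ on $\mathfrak{S}_0(T)$: for all $a_i\in\operatorname{Pic}(R_i)$ and $c_i\in\mathfrak{S}_0(R_i)$, $\phi(a_1+c_1,a_2+c_2)=\psi(a_1,a_2)+\phi(c_1,c_2)$. (c) The map $\phi$ induces a well-defined, relation-respecting map $\overline{\mathfrak{S}}_0(R_1)\times\overline{\mathfrak{S}}_0(R_2)\to\overline{\mathfrak{S}}_0(T)$ with $(\langle C_1\rangle,\langle C_2\rangle)\mapsto\langle C_1\otimes_D C_2\rangle$. -/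

import Mathlib

open TensorProduct CategoryTheory CategoryTheory.Abelian

universe u

/-! ### Semidualizing and totally reflexive modules -/

/-- `Ext_R^n(M, N) = 0` for all `n ≥ 1`. -/
def ExtPosVanish (R : Type u) [CommRing R] (M N : Type u) [AddCommGroup M] [Module R M]
    [AddCommGroup N] [Module R N] : Prop :=
  ∀ n : ℕ, 1 ≤ n → Subsingleton (Ext (ModuleCat.of R M) (ModuleCat.of R N) n)

/-- `C` is a semidualizing `R`-module (`R` is noetherian in all uses): it is finitely generated,
`Hom_R(C, C) ≅ R`, and `Ext_R^n(C, C) = 0` for all `n ≥ 1`. -/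
structure IsSemidualizing (R : Type u) [CommRing R] (C : Type u) [AddCommGroup C] [Module R C] :
    Prop where
  finite : Module.Finite R C
  hom : Nonempty ((C →ₗ[R] C) ≃ₗ[R] R)
  ext : ExtPosVanish R C C

/-- `M` is totally `C`-reflexive (for finitely generated `C` and `M` over a noetherian ring `R`):
`M ≅ Hom(Hom(M, C), C)` and `Ext^n(M, C) = 0 = Ext^n(Hom(M, C), C)` for all `n ≥ 1`. -/
structure IsTotallyReflexive (R : Type u) [CommRing R] (C M : Type u) [AddCommGroup C]
    [Module R C] [AddCommGroup M] [Module R M] : Prop where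
  bidual : Nonempty (M ≃ₗ[R] ((M →ₗ[R] C) →ₗ[R] C))
  ext : ExtPosVanish R M C
  ext_dual : ExtPosVanish R (M →ₗ[R] C) C

/-! ### Helper facts: invariance under isomorphism and under tensoring with invertible modules -/

section Helpers

variable {R : Type u} [CommRing R]
variable {M N X Y A B C M' C' : Type u} [AddCommGroup M] [Module R M] [AddCommGroup N] [Module R N]
  [AddCommGroup X] [Module R X] [AddCommGroup Y] [Module R Y] [AddCommGroup A] [Module R A]
  [AddCommGroup B] [Module R B] [AddCommGroup C] [Module R C] [AddCommGroup M'] [Module R M']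
  [AddCommGroup C'] [Module R C']

/-- `X` is a direct summand of a finite direct sum of copies of `M`. -/
def IsSummandOfPower (R : Type u) [CommRing R] (X M : Type u) [AddCommGroup X] [Module R X]
    [AddCommGroup M] [Module R M] : Prop :=
  ∃ (n : ℕ) (f : Fin n → X →ₗ[R] M) (g : Fin n → M →ₗ[R] X), ∑ j, g j ∘ₗ f j = LinearMap.id

theorem IsSummandOfPower.of_equiv (e : X ≃ₗ[R] M) : IsSummandOfPower R X M :=
  ⟨1, fun _ => e.toLinearMap, fun _ => e.symm.toLinearMap, by ext; simp⟩

theorem exists_dualBasis_of_invertible (A : Type u) [AddCommGroup A] [Module R A]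
    [Module.Invertible R A] :
    ∃ (n : ℕ) (φ : Fin n → A →ₗ[R] R) (a : Fin n → A), ∀ x, ∑ j, φ j x • a j = x := by
  obtain ⟨n, f, g, -, -, hfg⟩ := Module.Finite.exists_comp_eq_id_of_projective R A
  refine ⟨n, fun j => LinearMap.proj j ∘ₗ g, fun j => f (Pi.single j 1), fun x => ?_⟩
  have h := LinearMap.congr_fun hfg x
  simp only [LinearMap.comp_apply, LinearMap.id_apply] at h
  conv_rhs => rw [← h, pi_eq_sum_univ' (g x), map_sum]
  exact Finset.sum_congr rfl fun j _ => by rw [map_smul]; rfl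

theorem IsSummandOfPower.tensor [Module.Invertible R A] (e : X ≃ₗ[R] A ⊗[R] M) :
    IsSummandOfPower R X M := by
  obtain ⟨n, φ, a, h⟩ := exists_dualBasis_of_invertible (R := R) A
  refine ⟨n, fun j => TensorProduct.lift (LinearMap.lsmul R M ∘ₗ φ j) ∘ₗ e.toLinearMap,
    fun j => e.symm.toLinearMap ∘ₗ TensorProduct.mk R A M (a j), ?_⟩
  have key : ∑ j, (TensorProduct.mk R A M (a j)) ∘ₗ
      TensorProduct.lift (LinearMap.lsmul R M ∘ₗ φ j) = LinearMap.id := by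
    refine TensorProduct.ext' fun x m => ?_
    simp only [LinearMap.sum_apply, LinearMap.comp_apply, TensorProduct.lift.tmul,
      LinearMap.lsmul_apply, TensorProduct.mk_apply, LinearMap.id_apply]
    conv_rhs => rw [← h x, TensorProduct.sum_tmul]
    exact Finset.sum_congr rfl fun j _ => by rw [TensorProduct.smul_tmul]
  refine LinearMap.ext fun x => e.injective ?_
  have := LinearMap.congr_fun key (e x)
  simp only [LinearMap.sum_apply, LinearMap.comp_apply, LinearMap.id_apply] at this ⊢
  rw [map_sum]
  simpa using this

theorem ExtPosVanish.of_summand (h : ExtPosVanish R M N) (hX : IsSummandOfPower R X M)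
    (hY : IsSummandOfPower R Y N) : ExtPosVanish R X Y := by
  intro n hn
  have := h n hn
  obtain ⟨k, f, g, hfg⟩ := hX
  obtain ⟨l, f', g', hfg'⟩ := hY
  have hX : 𝟙 (ModuleCat.of R X) = ∑ j, ModuleCat.ofHom (f j) ≫ ModuleCat.ofHom (g j) := by
    ext x
    have := LinearMap.congr_fun hfg x
    simp only [LinearMap.sum_apply, LinearMap.comp_apply, LinearMap.id_apply] at this
    simp [ModuleCat.hom_sum, this]
  have hY : 𝟙 (ModuleCat.of R Y) = ∑ j, ModuleCat.ofHom (f' j) ≫ ModuleCat.ofHom (g' j) := by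
    ext x
    have := LinearMap.congr_fun hfg' x
    simp only [LinearMap.sum_apply, LinearMap.comp_apply, LinearMap.id_apply] at this
    simp [ModuleCat.hom_sum, this]
  have h1 : Subsingleton (Ext (ModuleCat.of R X) (ModuleCat.of R N) n) := by
    refine subsingleton_of_forall_eq 0 fun α => ?_
    rw [← Ext.mk₀_id_comp α, hX, Ext.mk₀_sum, Ext.sum_comp]
    refine Finset.sum_eq_zero fun j _ => ?_
    rw [← Ext.mk₀_comp_mk₀, Ext.comp_assoc _ _ _ (by simp) (zero_add n) (by simp),
      Subsingleton.elim ((Ext.mk₀ (ModuleCat.ofHom (g j))).comp α _) 0, Ext.comp_zero]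
  refine subsingleton_of_forall_eq 0 fun α => ?_
  rw [← Ext.comp_mk₀_id α, hY, Ext.mk₀_sum, Ext.comp_sum]
  refine Finset.sum_eq_zero fun j _ => ?_
  rw [← Ext.mk₀_comp_mk₀, ← Ext.comp_assoc _ _ _ (add_zero n) (by simp) (by simp),
    Subsingleton.elim (α.comp (Ext.mk₀ (ModuleCat.ofHom (f' j))) _) 0, Ext.zero_comp]

theorem nonempty_hom_tensor_left (e : A ⊗[R] B ≃ₗ[R] R) :
    Nonempty ((A ⊗[R] X →ₗ[R] Y) ≃ₗ[R] (X →ₗ[R] Y) ⊗[R] B) :=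
  ⟨(TensorProduct.lift.equiv (.id R) A X Y).symm ≪≫ₗ
    Module.Invertible.rTensorEquiv A (X →ₗ[R] Y) (TensorProduct.comm R B A ≪≫ₗ e) ≪≫ₗ
    LinearEquiv.arrowCongr e (LinearEquiv.refl R _) ≪≫ₗ
    LinearMap.ringLmapEquivSelf R R ((X →ₗ[R] Y) ⊗[R] B)⟩

theorem nonempty_hom_tensor_right (e : A ⊗[R] B ≃ₗ[R] R) :
    Nonempty ((X →ₗ[R] A ⊗[R] Y) ≃ₗ[R] (X →ₗ[R] Y) ⊗[R] A) := by
  have e' := TensorProduct.comm R B A ≪≫ₗ e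
  obtain ⟨k⟩ := nonempty_hom_tensor_left (X := X) (Y := Y) e'
  exact ⟨Module.Invertible.rTensorEquiv X (A ⊗[R] Y) e' ≪≫ₗ
    LinearEquiv.arrowCongr (TensorProduct.comm R X B)
      (TensorProduct.assoc R A Y B ≪≫ₗ (TensorProduct.comm R Y B).lTensor A ≪≫ₗ
        (TensorProduct.assoc R A B Y).symm ≪≫ₗ e.rTensor Y ≪≫ₗ TensorProduct.lid R Y) ≪≫ₗ k⟩

theorem IsSemidualizing.congr (h : IsSemidualizing R C) (e : C ≃ₗ[R] C') :
    IsSemidualizing R C' where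
  finite := have := h.finite; Module.Finite.equiv e
  hom := ⟨LinearEquiv.arrowCongr e.symm e.symm ≪≫ₗ h.hom.some⟩
  ext := h.ext.of_summand (.of_equiv e.symm) (.of_equiv e.symm)

theorem IsSemidualizing.tensor [Module.Invertible R A] (h : IsSemidualizing R C) :
    IsSemidualizing R (A ⊗[R] C) where
  finite := have := h.finite; inferInstance
  hom := by
    have e := TensorProduct.comm R A (Module.Dual R A) ≪≫ₗ Module.Invertible.linearEquiv R A
    exact ⟨LinearEquiv.arrowCongr (TensorProduct.comm R A C) (TensorProduct.comm R A C) ≪≫ₗ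
      (Module.Invertible.rTensorEquiv C C e).symm ≪≫ₗ h.hom.some⟩
  ext := h.ext.of_summand (.tensor (LinearEquiv.refl R _)) (.tensor (LinearEquiv.refl R _))

theorem IsSemidualizing.of_invertible (R : Type u) [CommRing R] (A : Type u) [AddCommGroup A]
    [Module R A] [Module.Invertible R A] : IsSemidualizing R A where
  finite := inferInstance
  hom := by
    have e := TensorProduct.comm R A (Module.Dual R A) ≪≫ₗ Module.Invertible.linearEquiv R A
    exact ⟨LinearEquiv.arrowCongr (TensorProduct.lid R A).symm (TensorProduct.lid R A).symm ≪≫ₗ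
      (Module.Invertible.rTensorEquiv R R e).symm ≪≫ₗ LinearMap.ringLmapEquivSelf R R R⟩
  ext n hn := by
    obtain ⟨m, rfl⟩ : ∃ m, n = m + 1 := ⟨n - 1, by omega⟩
    have : Projective (ModuleCat.of R A) :=
      (IsProjective.iff_projective (R := R) (P := A)).1 inferInstance
    exact subsingleton_of_forall_eq 0 Ext.eq_zero_of_projective

theorem IsTotallyReflexive.congr (h : IsTotallyReflexive R C M) (eC : C ≃ₗ[R] C')
    (eM : M ≃ₗ[R] M') : IsTotallyReflexive R C' M' where
  bidual := ⟨eM.symm ≪≫ₗ h.bidual.some ≪≫ₗ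
    LinearEquiv.arrowCongr (LinearEquiv.arrowCongr eM eC) eC⟩
  ext := h.ext.of_summand (.of_equiv eM.symm) (.of_equiv eC.symm)
  ext_dual := h.ext_dual.of_summand (.of_equiv (LinearEquiv.arrowCongr eM eC).symm)
    (.of_equiv eC.symm)

theorem IsTotallyReflexive.tensor_left [Module.Invertible R A] (h : IsTotallyReflexive R C M) :
    IsTotallyReflexive R (A ⊗[R] C) M := by
  have e := TensorProduct.comm R A (Module.Dual R A) ≪≫ₗ Module.Invertible.linearEquiv R A
  obtain ⟨k⟩ := nonempty_hom_tensor_right (X := M) (Y := C) e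
  refine ⟨?_, h.ext.of_summand (.of_equiv (LinearEquiv.refl R M))
    (.tensor (LinearEquiv.refl R _)), h.ext_dual.of_summand
    (.tensor (k ≪≫ₗ TensorProduct.comm R _ _)) (.tensor (LinearEquiv.refl R _))⟩
  exact ⟨h.bidual.some ≪≫ₗ Module.Invertible.rTensorEquiv (M →ₗ[R] C) C e ≪≫ₗ
    LinearEquiv.arrowCongr k.symm (TensorProduct.comm R C A)⟩

theorem IsTotallyReflexive.tensor_right [Module.Invertible R A] (h : IsTotallyReflexive R C M) :
    IsTotallyReflexive R C (A ⊗[R] M) := by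
  have e := TensorProduct.comm R A (Module.Dual R A) ≪≫ₗ Module.Invertible.linearEquiv R A
  obtain ⟨k⟩ := nonempty_hom_tensor_left (X := M) (Y := C) e
  obtain ⟨k'⟩ := nonempty_hom_tensor_left (X := M →ₗ[R] C) (Y := C)
    (TensorProduct.comm R _ _ ≪≫ₗ e)
  refine ⟨?_, h.ext.of_summand (.tensor (LinearEquiv.refl R _)) (.of_equiv (LinearEquiv.refl R C)),
    h.ext_dual.of_summand (.tensor (k ≪≫ₗ TensorProduct.comm R _ _))
      (.of_equiv (LinearEquiv.refl R C))⟩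
  exact ⟨h.bidual.some.lTensor A ≪≫ₗ TensorProduct.comm R _ _ ≪≫ₗ k'.symm ≪≫ₗ
    LinearEquiv.arrowCongr (TensorProduct.comm R _ _ ≪≫ₗ k.symm) (LinearEquiv.refl R C)⟩

theorem isTotallyReflexive_tensor_iff [Module.Invertible R A] [Module.Invertible R B] :
    IsTotallyReflexive R (A ⊗[R] C) (B ⊗[R] M) ↔ IsTotallyReflexive R C M := by
  have aux : ∀ {P Q : Type u} [AddCommGroup P] [AddCommGroup Q] [Module R P] [Module R Q]
      [Module.Invertible R P],
      Nonempty (Module.Dual R P ⊗[R] (P ⊗[R] Q) ≃ₗ[R] Q) := fun {P Q} _ _ _ _ _ =>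
    ⟨Module.Invertible.leftCancelEquiv Q (Module.Invertible.linearEquiv R P)⟩
  refine ⟨fun h => ?_, fun h => h.tensor_left.tensor_right⟩
  exact ((h.tensor_left (A := Module.Dual R A)).tensor_right (A := Module.Dual R B)).congr
    aux.some aux.some

end Helpers

/-! ### The set `𝔖₀(R)`, its relation, and the action of the Picard group -/

/-- Semidualizing `R`-modules, up to isomorphism. -/
instance semidualizingSetoid (R : Type u) [CommRing R] :
    Setoid {C : ModuleCat.{u} R // IsSemidualizing R C} where
  r C C' := Nonempty (C.1 ≃ₗ[R] C'.1)
  iseqv := ⟨fun _ => ⟨LinearEquiv.refl R _⟩, fun ⟨e⟩ => ⟨e.symm⟩, fun ⟨e⟩ ⟨e'⟩ => ⟨e ≪≫ₗ e'⟩⟩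

/-- `𝔖₀(R)`: the set of isomorphism classes of semidualizing `R`-modules. -/
def SZero (R : Type u) [CommRing R] : Type (u + 1) :=
  Quotient (semidualizingSetoid R)

namespace SZero

variable {R : Type u} [CommRing R]

/-- The class `[C]` in `𝔖₀(R)` of a semidualizing module `C`. -/
def mk (C : Type u) [AddCommGroup C] [Module R C] (h : IsSemidualizing R C) : SZero R :=
  Quotient.mk _ ⟨ModuleCat.of R C, h⟩

theorem mk_eq_mk_iff {C C' : Type u} [AddCommGroup C] [Module R C] [AddCommGroup C'] [Module R C']
    {h : IsSemidualizing R C} {h' : IsSemidualizing R C'} :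
    mk C h = mk C' h' ↔ Nonempty (C ≃ₗ[R] C') :=
  Quotient.eq

/-- The relation `[C] ⊴ [M]` on `𝔖₀(R)`: the module `M` is totally `C`-reflexive. -/
def Rel : SZero R → SZero R → Prop :=
  Quotient.lift₂ (fun C M => IsTotallyReflexive R C.1 M.1) fun _ _ _ _ ⟨eC⟩ ⟨eM⟩ =>
    propext ⟨fun h => h.congr eC eM, fun h => h.congr eC.symm eM.symm⟩

/-- The action `[𝔞] • [C] = [𝔞 ⊗ C]` of the Picard group (written multiplicatively) on `𝔖₀(R)`. -/
noncomputable instance : MulAction (CommRing.Pic R) (SZero R) where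
  smul a := Quotient.map (fun C => ⟨ModuleCat.of R (a.AsModule ⊗[R] C.1), C.2.tensor⟩)
    fun _ _ ⟨e⟩ => ⟨e.lTensor a.AsModule⟩
  one_smul := by
    rintro ⟨C⟩
    obtain ⟨e⟩ := CommRing.Pic.mk_eq_iff.1 (CommRing.Pic.mk_self (R := R))
    exact Quotient.sound ⟨e.symm.rTensor C.1 ≪≫ₗ TensorProduct.lid R C.1⟩
  mul_smul := by
    rintro a b ⟨C⟩
    obtain ⟨e⟩ := CommRing.Pic.mk_eq_iff.1 (CommRing.Pic.mul_eq_tensor a b).symm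
    exact Quotient.sound ⟨e.symm.rTensor C.1 ≪≫ₗ TensorProduct.assoc R _ _ _⟩

theorem mk_smul_mk (A C : Type u) [AddCommGroup A] [Module R A] [Module.Invertible R A]
    [AddCommGroup C] [Module R C] (h : IsSemidualizing R C) :
    CommRing.Pic.mk R A • mk C h = mk (A ⊗[R] C) h.tensor :=
  Quotient.sound ⟨(CommRing.Pic.mk.linearEquiv R A).rTensor C⟩

/-- The natural inclusion `Pic(R) ⊆ 𝔖₀(R)`, `[𝔞] ↦ [𝔞]`. -/
noncomputable def ofPic (a : CommRing.Pic R) : SZero R :=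
  mk a.AsModule (.of_invertible R a.AsModule)

theorem ofPic_mk (A : Type u) [AddCommGroup A] [Module R A] [Module.Invertible R A] :
    ofPic (CommRing.Pic.mk R A) = mk A (.of_invertible R A) :=
  Quotient.sound ⟨CommRing.Pic.mk.linearEquiv R A⟩

theorem ofPic_injective : Function.Injective (ofPic (R := R)) := fun _ _ h =>
  CommRing.Pic.ext_iff.2 (mk_eq_mk_iff.1 h)

theorem rel_smul_smul_iff (a b : CommRing.Pic R) (c m : SZero R) :
    Rel (a • c) (b • m) ↔ Rel c m := by
  obtain ⟨C⟩ := c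
  obtain ⟨M⟩ := m
  exact isTotallyReflexive_tensor_iff (A := a.AsModule) (B := b.AsModule)

end SZero

/-- `𝔖̄₀(R)`: the orbit space of `𝔖₀(R)` under the action of `Pic(R)`. -/
abbrev SZeroBar (R : Type u) [CommRing R] : Type (u + 1) :=
  MulAction.orbitRel.Quotient (CommRing.Pic R) (SZero R)

namespace SZeroBar

variable {R : Type u} [CommRing R]

/-- The orbit of an element of `𝔖₀(R)`. -/
noncomputable def mk (c : SZero R) : SZeroBar R :=
  Quotient.mk _ c

/-- The relation on `𝔖̄₀(R)` induced by that on `𝔖₀(R)`. -/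
def Rel : SZeroBar R → SZeroBar R → Prop :=
  Quotient.lift₂ SZero.Rel fun _ _ c m ⟨a, ha⟩ ⟨b, hb⟩ => by
    subst ha hb
    exact propext (SZero.rel_smul_smul_iff a b c m)

theorem rel_mk_mk (c m : SZero R) : Rel (mk c) (mk m) ↔ SZero.Rel c m := Iff.rfl

end SZeroBar

/-! ### The tensor product over `D` of an `R₁`-module and an `R₂`-module -/

/-- The tensor product `M₁ ⊗_D M₂`, to be considered as a module over `R₁ ⊗_D R₂`.
(A type synonym, since `M₁ ⊗_D M₂` may carry other module structures already.) -/
def OuterTensor (D M₁ M₂ : Type u) [CommRing D] [AddCommGroup M₁] [AddCommGroup M₂] [Module D M₁]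
    [Module D M₂] : Type u :=
  M₁ ⊗[D] M₂

namespace OuterTensor

variable {D R₁ R₂ M₁ M₂ : Type u} [CommRing D] [CommRing R₁] [CommRing R₂] [Algebra D R₁]
  [Algebra D R₂] [AddCommGroup M₁] [AddCommGroup M₂] [Module D M₁] [Module D M₂] [Module R₁ M₁]
  [Module R₂ M₂] [IsScalarTower D R₁ M₁] [IsScalarTower D R₂ M₂]

noncomputable instance : AddCommGroup (OuterTensor D M₁ M₂) :=
  inferInstanceAs (AddCommGroup (M₁ ⊗[D] M₂))

/-- The `R₁ ⊗_D R₂`-module structure on `M₁ ⊗_D M₂`, with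
`(r₁ ⊗ r₂) • (m₁ ⊗ m₂) = (r₁ • m₁) ⊗ (r₂ • m₂)`. -/
noncomputable instance : Module (R₁ ⊗[D] R₂) (OuterTensor D M₁ M₂) :=
  Module.compHom (M₁ ⊗[D] M₂)
    (((Module.endTensorEndAlgHom (R := D) (S := D) (A := D) (M := M₁) (N := M₂)).comp
      (Algebra.TensorProduct.map (Algebra.lsmul D D M₁ : R₁ →ₐ[D] Module.End D M₁)
        (Algebra.lsmul D D M₂ : R₂ →ₐ[D] Module.End D M₂))).toRingHom :
      R₁ ⊗[D] R₂ →+* Module.End D (M₁ ⊗[D] M₂))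

theorem tmul_smul_tmul (r₁ : R₁) (r₂ : R₂) (m₁ : M₁) (m₂ : M₂) :
    (r₁ ⊗ₜ[D] r₂) • (show OuterTensor D M₁ M₂ from m₁ ⊗ₜ[D] m₂) =
      (show OuterTensor D M₁ M₂ from (r₁ • m₁) ⊗ₜ[D] (r₂ • m₂)) :=
  rfl

end OuterTensor

/-! `R₁ ⊗_D R₂` is an `R₂`-algebra via `r₂ ↦ 1 ⊗ r₂` (the `R₁`-algebra structure `r₁ ↦ r₁ ⊗ 1` is a
global instance). -/
attribute [local instance] Algebra.TensorProduct.rightAlgebra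

/-! ### Torsion-freeness -/

/-! A semidualizing module over a noetherian domain is torsion-free
(`IsSemidualizing.isTorsionFree`). Since `D` embeds in each `Rᵢ`, torsion-free `Rᵢ`-modules are
torsion-free over `D`, hence flat over the principal ideal domain `D`. This makes tensor products
over `D` exact where needed, so that the two factors can be treated one at a time.

Two facts about finitely generated `Mᵢ` and torsion-free `Nᵢ` then carry the theorem. By
`OuterTensor.homMap_bijective`, the module of `T`-linear maps from `M₁ ⊗_D M₂` to `N₁ ⊗_D N₂` is
`Hom(M₁, N₁) ⊗_D Hom(M₂, N₂)`; this is clear for free sources and passes to all others by finite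
presentations and the five lemma. By `OuterTensor.extPosVanish`, if `M₁` is also torsion-free,
vanishing of positive `Ext` on both factors gives vanishing over `T`; this is dimension shifting
along syzygies, where the isomorphism of Hom modules settles degree one.

With `Mᵢ = Nᵢ = Cᵢ` these facts say that `C₁ ⊗_D C₂` is semidualizing. Applied to `Mᵢ` and then to
the duals `Hom(Mᵢ, Cᵢ)`, they give preservation of total reflexivity.

The Picard statements rest on the interchange isomorphism `OuterTensor.tensorTensorEquiv`, which is
valid over any `D`. It yields invertibility, the product formulas and equivariance, and equivariance
makes the map descend to orbits. -/

theorem IsSemidualizing.isTorsionFree {R C : Type u} [CommRing R] [IsDomain R] [IsNoetherianRing R]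
    [AddCommGroup C] [Module R C] (h : IsSemidualizing R C) : Module.IsTorsionFree R C := by
  have := h.finite
  obtain ⟨e⟩ := h.hom
  have hEnd : ∀ (r : R) (f : C →ₗ[R] C), r ≠ 0 → r • f = 0 → f = 0 := fun r f hr hf => by
    have h0 : r * e f = 0 := by rw [← smul_eq_mul, ← map_smul, hf, map_zero]
    exact e.map_eq_zero_iff.1 ((mul_eq_zero.1 h0).resolve_left hr)
  refine .of_smul_eq_zero fun r c hrc => or_iff_not_imp_left.2 fun hr => ?_
  let K := Submodule.torsionBy R C r
  -- A map from `C` to the `r`-torsion `K` becomes an endomorphism of `C` killed by `r`, and `C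
  -- →ₗ[R] C ≅ R` has no torsion.
  have hK : Subsingleton (C →ₗ[R] K) := by
    refine subsingleton_of_forall_eq 0 fun f => ?_
    have h0 : K.subtype ∘ₗ f = 0 := hEnd r _ hr (LinearMap.ext fun x => (f x).2)
    exact LinearMap.ext fun x => Subtype.ext (LinearMap.congr_fun h0 x)
  -- Over a noetherian ring, absence of nonzero maps from `C` to `K` forces some `s` in the
  -- annihilator of `C` to be regular on `K`. The annihilator is zero because `C →ₗ[R] C ≅ R` is
  -- faithful, so `0` is regular on `K` and `K = 0`.
  obtain ⟨s, hs, hreg⟩ := IsSMulRegular.subsingleton_linearMap_iff.1 hK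
  have hs0 : s = 0 := by
    by_contra hs0
    have h1 : e.symm 1 = 0 := hEnd s _ hs0 <| LinearMap.ext fun x =>
      (Module.mem_annihilator.1 hs _)
    exact one_ne_zero ((LinearEquiv.map_eq_zero_iff _).1 h1)
  have := @hreg ⟨c, hrc⟩ 0 (by simp [hs0])
  exact congrArg Subtype.val this

theorem Module.IsTorsionFree.linearMap (R M N : Type*) [CommRing R] [IsDomain R]
    [AddCommGroup M] [Module R M] [AddCommGroup N] [Module R N] [Module.IsTorsionFree R N] :
    Module.IsTorsionFree R (M →ₗ[R] N) :=
  .of_smul_eq_zero fun _ _ h => or_iff_not_imp_left.2 fun hr => LinearMap.ext fun x =>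
    (smul_eq_zero.1 (LinearMap.congr_fun h x)).resolve_left hr

theorem Module.IsTorsionFree.restrictScalars_of_injective {D R : Type*} (M : Type*) [CommRing D]
    [IsDomain D] [CommRing R] [IsDomain R] [Algebra D R] [AddCommGroup M] [Module R M] [Module D M]
    [IsScalarTower D R M] (h : Function.Injective (algebraMap D R)) [Module.IsTorsionFree R M] :
    Module.IsTorsionFree D M :=
  .of_smul_eq_zero fun d m hm => by
    rw [← algebraMap_smul R d m, smul_eq_zero] at hm
    exact hm.imp_left fun h0 => h (by rw [h0, map_zero])

theorem Module.IsTorsionFree.flat_of_injective {D R : Type*} (M : Type*) [CommRing D]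
    [IsDomain D] [IsPrincipalIdealRing D] [CommRing R] [IsDomain R] [Algebra D R] [AddCommGroup M]
    [Module R M] [Module D M] [IsScalarTower D R M] (h : Function.Injective (algebraMap D R))
    [Module.IsTorsionFree R M] : Module.Flat D M :=
  have := Module.IsTorsionFree.restrictScalars_of_injective M h
  inferInstance

/-! ### Dimension shifting for `Ext` -/

section DimensionShift

variable {R : Type u} [CommRing R] {K P M : Type u} (N : Type u) [AddCommGroup K] [Module R K]
  [AddCommGroup P] [Module R P] [AddCommGroup M] [Module R M] [AddCommGroup N] [Module R N]
  {f : K →ₗ[R] P} {g : P →ₗ[R] M}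

theorem ModuleCat.shortExact_of_exact (hf : Function.Injective f) (hfg : Function.Exact f g)
    (hg : Function.Surjective g) :
    (ShortComplex.mk (ModuleCat.ofHom f) (ModuleCat.ofHom g)
      (by rw [← ModuleCat.ofHom_comp, hfg.linearMap_comp_eq_zero]; rfl)).ShortExact where
  exact := (ShortComplex.ShortExact.moduleCat_exact_iff_function_exact _).2 hfg
  mono_f := (ModuleCat.mono_iff_injective _).2 hf
  epi_g := (ModuleCat.epi_iff_surjective _).2 hg

/-- When `Ext¹(P, N) = 0`, the group `Ext¹(M, N)` is the cokernel of restriction `Hom(P, N) → Hom(K,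
N)`. -/
theorem subsingleton_ext_one (hf : Function.Injective f) (hfg : Function.Exact f g)
    (hg : Function.Surjective g) (hP : Subsingleton (Ext (ModuleCat.of R P) (ModuleCat.of R N) 1))
    (hext : ∀ k : K →ₗ[R] N, ∃ p : P →ₗ[R] N, p ∘ₗ f = k) :
    Subsingleton (Ext (ModuleCat.of R M) (ModuleCat.of R N) 1) := by
  have hS := ModuleCat.shortExact_of_exact hf hfg hg
  refine subsingleton_of_forall_eq 0 fun x => ?_
  obtain ⟨y, rfl⟩ := Ext.contravariant_sequence_exact₃ hS (ModuleCat.of R N) x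
    (Subsingleton.elim _ _) (add_zero 1)
  obtain ⟨k, rfl⟩ := Ext.addEquiv₀.symm.surjective y
  obtain ⟨p, hp⟩ := hext k.hom
  have hk : k = ModuleCat.ofHom f ≫ ModuleCat.ofHom p := ModuleCat.hom_ext hp.symm
  rw [Ext.addEquiv₀_symm_apply, hk, ← Ext.mk₀_comp_mk₀]
  -- The class is now the extension class followed by `f` and then `p`; the first composite is zero.
  exact hS.extClass_comp_assoc _

/-- In the long exact sequence, `Ext^{n+1}(M, N)` sits between `Ext^n(K, N)` and `Ext^{n+1}(P, N)`.
-/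
theorem subsingleton_ext_succ (hf : Function.Injective f) (hfg : Function.Exact f g)
    (hg : Function.Surjective g) (n : ℕ)
    (hP : Subsingleton (Ext (ModuleCat.of R P) (ModuleCat.of R N) (n + 1)))
    (hK : Subsingleton (Ext (ModuleCat.of R K) (ModuleCat.of R N) n)) :
    Subsingleton (Ext (ModuleCat.of R M) (ModuleCat.of R N) (n + 1)) := by
  have hS := ModuleCat.shortExact_of_exact hf hfg hg
  refine subsingleton_of_forall_eq 0 fun x => ?_
  obtain ⟨y, rfl⟩ := Ext.contravariant_sequence_exact₃ hS (ModuleCat.of R N) x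
    (Subsingleton.elim _ _) (add_comm 1 n)
  rw [hK.elim y 0, Ext.comp_zero]

/-- The obstruction to extending `k` to `P` is its image under the connecting map to `Ext¹(M, N) =
0`. -/
theorem ExtPosVanish.exists_extension (hf : Function.Injective f) (hfg : Function.Exact f g)
    (hg : Function.Surjective g) (hM : ExtPosVanish R M N) (k : K →ₗ[R] N) :
    ∃ p : P →ₗ[R] N, p ∘ₗ f = k := by
  have hS := ModuleCat.shortExact_of_exact hf hfg hg
  have := hM 1 le_rfl
  obtain ⟨y, hy⟩ := Ext.contravariant_sequence_exact₁ hS (ModuleCat.of R N)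
    (Ext.mk₀ (ModuleCat.ofHom k)) (add_zero 1) (Subsingleton.elim _ _)
  obtain ⟨p, rfl⟩ := Ext.addEquiv₀.symm.surjective y
  refine ⟨p.hom, ?_⟩
  rw [Ext.addEquiv₀_symm_apply, Ext.mk₀_comp_mk₀] at hy
  exact congrArg ModuleCat.Hom.hom ((Ext.mk₀_bijective _ _).1 hy)

/-- `Ext^n(K, N)` sits between `Ext^n(P, N)` and `Ext^{n+1}(M, N)`. Thus the vanishing hypothesis
passes to syzygies, which keeps the later inductions running. -/
theorem ExtPosVanish.kernel (hf : Function.Injective f) (hfg : Function.Exact f g)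
    (hg : Function.Surjective g) (hM : ExtPosVanish R M N) (hP : ExtPosVanish R P N) :
    ExtPosVanish R K N := by
  intro n hn
  have hS := ModuleCat.shortExact_of_exact hf hfg hg
  refine subsingleton_of_forall_eq 0 fun x => ?_
  have := hM (1 + n) (by omega)
  obtain ⟨y, rfl⟩ := Ext.contravariant_sequence_exact₁ hS (ModuleCat.of R N) x rfl
    (Subsingleton.elim _ _)
  rw [(hP n hn).elim y 0, Ext.comp_zero]

theorem ExtPosVanish.of_projective [Module.Projective R M] : ExtPosVanish R M N := by
  intro n hn
  obtain ⟨m, rfl⟩ : ∃ m, n = m + 1 := ⟨n - 1, by omega⟩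
  have : Projective (ModuleCat.of R M) :=
    (IsProjective.iff_projective (R := R) (P := M)).1 inferInstance
  exact subsingleton_of_forall_eq 0 Ext.eq_zero_of_projective

end DimensionShift

/-! ### Maps between outer tensor products -/

namespace OuterTensor

section

variable (D : Type u) {M₁ M₂ : Type u} [CommRing D] [AddCommGroup M₁] [AddCommGroup M₂]
  [Module D M₁] [Module D M₂]

/-- The pure tensor `m₁ ⊗ m₂` in the outer tensor product. -/
def tmul (m₁ : M₁) (m₂ : M₂) : OuterTensor D M₁ M₂ :=
  m₁ ⊗ₜ[D] m₂

theorem tmul_add (m₁ : M₁) (m₂ m₂' : M₂) : tmul D m₁ (m₂ + m₂') = tmul D m₁ m₂ + tmul D m₁ m₂' :=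
  TensorProduct.tmul_add _ _ _

theorem add_tmul (m₁ m₁' : M₁) (m₂ : M₂) : tmul D (m₁ + m₁') m₂ = tmul D m₁ m₂ + tmul D m₁' m₂ :=
  TensorProduct.add_tmul _ _ _

theorem tmul_sum {ι : Type*} (s : Finset ι) (m₁ : M₁) (m₂ : ι → M₂) :
    tmul D m₁ (∑ i ∈ s, m₂ i) = ∑ i ∈ s, tmul D m₁ (m₂ i) :=
  TensorProduct.tmul_sum _ _ _

theorem sum_tmul {ι : Type*} (s : Finset ι) (m₁ : ι → M₁) (m₂ : M₂) :
    tmul D (∑ i ∈ s, m₁ i) m₂ = ∑ i ∈ s, tmul D (m₁ i) m₂ :=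
  TensorProduct.sum_tmul _ _ _

variable {D}

@[elab_as_elim]
theorem induction {p : OuterTensor D M₁ M₂ → Prop} (x : OuterTensor D M₁ M₂) (zero : p 0)
    (tmul : ∀ m₁ m₂, p (tmul D m₁ m₂)) (add : ∀ x y, p x → p y → p (x + y)) : p x :=
  TensorProduct.induction_on x zero tmul add

end

variable {D R₁ R₂ : Type u} [CommRing D] [CommRing R₁] [CommRing R₂] [Algebra D R₁] [Algebra D R₂]
  {M₁ M₂ M₁' M₂' M₁'' M₂'' : Type u}
  [AddCommGroup M₁] [Module D M₁] [Module R₁ M₁] [IsScalarTower D R₁ M₁]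
  [AddCommGroup M₂] [Module D M₂] [Module R₂ M₂] [IsScalarTower D R₂ M₂]
  [AddCommGroup M₁'] [Module D M₁'] [Module R₁ M₁'] [IsScalarTower D R₁ M₁']
  [AddCommGroup M₂'] [Module D M₂'] [Module R₂ M₂'] [IsScalarTower D R₂ M₂']
  [AddCommGroup M₁''] [Module D M₁''] [Module R₁ M₁''] [IsScalarTower D R₁ M₁'']
  [AddCommGroup M₂''] [Module D M₂''] [Module R₂ M₂''] [IsScalarTower D R₂ M₂'']
  {X : Type u} [AddCommGroup X] [Module (R₁ ⊗[D] R₂) X]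

/-- The defining formula for the action, restated for `tmul` so that it can be used for rewriting.
-/
theorem smul_tmul (r₁ : R₁) (r₂ : R₂) (m₁ : M₁) (m₂ : M₂) :
    (r₁ ⊗ₜ[D] r₂) • tmul D m₁ m₂ = tmul D (r₁ • m₁) (r₂ • m₂) :=
  rfl

theorem isLinear_of_tmul (f : OuterTensor D M₁ M₂ →+ X)
    (hf : ∀ (r₁ : R₁) (r₂ : R₂) m₁ m₂,
      f (tmul D (r₁ • m₁) (r₂ • m₂)) = (r₁ ⊗ₜ[D] r₂) • f (tmul D m₁ m₂))
    (t : R₁ ⊗[D] R₂) (x : OuterTensor D M₁ M₂) : f (t • x) = t • f x := by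
  induction t using TensorProduct.induction_on with
  | zero => simp
  | add s t hs ht => rw [add_smul, add_smul, map_add, hs, ht]
  | tmul r₁ r₂ =>
    induction x using OuterTensor.induction with
    | zero => simp
    | tmul m₁ m₂ => rw [smul_tmul, hf]
    | add x y hx hy => rw [smul_add, map_add, map_add, smul_add, hx, hy]

/-- The universal property of the outer tensor product: a biadditive map that is compatible with
the scalar actions induces a linear map. -/
noncomputable def lift (f : M₁ →+ M₂ →+ X)
    (hf : ∀ (r₁ : R₁) (r₂ : R₂) m₁ m₂, f (r₁ • m₁) (r₂ • m₂) = (r₁ ⊗ₜ[D] r₂) • f m₁ m₂) :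
    OuterTensor D M₁ M₂ →ₗ[R₁ ⊗[D] R₂] X :=
  -- Balancing over `D` is automatic: `d` acts through either factor as the same element `(d • 1) ⊗
  -- 1 = 1 ⊗ (d • 1)`.
  have h (d : D) (m₁ : M₁) (m₂ : M₂) : f (d • m₁) m₂ = f m₁ (d • m₂) := by
    rw [← algebraMap_smul R₁ d m₁, ← algebraMap_smul R₂ d m₂, ← one_smul R₂ m₂, hf,
      one_smul R₂ m₂, ← one_smul R₁ m₁, hf, one_smul R₁ m₁, Algebra.algebraMap_eq_smul_one,
      Algebra.algebraMap_eq_smul_one, TensorProduct.smul_tmul]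
  let F : OuterTensor D M₁ M₂ →+ X := TensorProduct.liftAddHom f h
  { F with map_smul' := isLinear_of_tmul F hf }

theorem hom_ext {f g : OuterTensor D M₁ M₂ →ₗ[R₁ ⊗[D] R₂] X}
    (h : ∀ m₁ m₂, f (tmul D m₁ m₂) = g (tmul D m₁ m₂)) : f = g :=
  LinearMap.ext fun x => by
    induction x using OuterTensor.induction with
    | zero => simp
    | tmul m₁ m₂ => exact h m₁ m₂
    | add x y hx hy => rw [map_add, map_add, hx, hy]

/-- The outer tensor product of two linear maps. -/
noncomputable def map (f₁ : M₁ →ₗ[R₁] M₁') (f₂ : M₂ →ₗ[R₂] M₂') :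
    OuterTensor D M₁ M₂ →ₗ[R₁ ⊗[D] R₂] OuterTensor D M₁' M₂' :=
  let F : OuterTensor D M₁ M₂ →+ OuterTensor D M₁' M₂' :=
    (TensorProduct.map (f₁.restrictScalars D) (f₂.restrictScalars D)).toAddMonoidHom
  { F with
    map_smul' := isLinear_of_tmul F fun r₁ r₂ m₁ m₂ => by
      change tmul D (f₁ (r₁ • m₁)) (f₂ (r₂ • m₂)) = (r₁ ⊗ₜ[D] r₂) • tmul D (f₁ m₁) (f₂ m₂)
      rw [map_smul, map_smul, smul_tmul] }

@[simp]
theorem map_tmul (f₁ : M₁ →ₗ[R₁] M₁') (f₂ : M₂ →ₗ[R₂] M₂') (m₁ : M₁) (m₂ : M₂) :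
    map f₁ f₂ (tmul D m₁ m₂) = tmul D (f₁ m₁) (f₂ m₂) :=
  rfl

/-- The outer tensor product of two linear equivalences. -/
noncomputable def congr (e₁ : M₁ ≃ₗ[R₁] M₁') (e₂ : M₂ ≃ₗ[R₂] M₂') :
    OuterTensor D M₁ M₂ ≃ₗ[R₁ ⊗[D] R₂] OuterTensor D M₁' M₂' :=
  .ofLinearMap (map e₁.toLinearMap e₂.toLinearMap) (map e₁.symm.toLinearMap e₂.symm.toLinearMap)
    (hom_ext fun _ _ => by simp) (hom_ext fun _ _ => by simp)

/-- `R₁ ⊗_D R₂` is the outer tensor product of `R₁` and `R₂`. -/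
noncomputable def ringEquiv (D R₁ R₂ : Type u) [CommRing D] [CommRing R₁] [CommRing R₂] [Algebra D R₁]
    [Algebra D R₂] : OuterTensor D R₁ R₂ ≃ₗ[R₁ ⊗[D] R₂] R₁ ⊗[D] R₂ :=
  let F : OuterTensor D R₁ R₂ ≃+ R₁ ⊗[D] R₂ := AddEquiv.refl (R₁ ⊗[D] R₂)
  { F with
    map_smul' := isLinear_of_tmul F.toAddMonoidHom fun r₁ r₂ m₁ m₂ =>
      (Algebra.TensorProduct.tmul_mul_tmul r₁ m₁ r₂ m₂).symm }

theorem map_surjective {f₁ : M₁ →ₗ[R₁] M₁'} {f₂ : M₂ →ₗ[R₂] M₂'} (h₁ : Function.Surjective f₁)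
    (h₂ : Function.Surjective f₂) : Function.Surjective (map (D := D) f₁ f₂) :=
  TensorProduct.map_surjective (g := f₁.restrictScalars D) (g' := f₂.restrictScalars D) h₁ h₂

theorem map_id_injective [Module.Flat D M₁] {f₂ : M₂ →ₗ[R₂] M₂'} (h₂ : Function.Injective f₂) :
    Function.Injective (map (D := D) (.id : M₁ →ₗ[R₁] M₁) f₂) :=
  Module.Flat.lTensor_preserves_injective_linearMap (f₂.restrictScalars D) h₂

theorem map_injective_id [Module.Flat D M₂] {f₁ : M₁ →ₗ[R₁] M₁'} (h₁ : Function.Injective f₁) :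
    Function.Injective (map (D := D) f₁ (.id : M₂ →ₗ[R₂] M₂)) :=
  Module.Flat.rTensor_preserves_injective_linearMap (f₁.restrictScalars D) h₁

variable (M₁ M₂) in
theorem map_id_exact {f₂ : M₂ →ₗ[R₂] M₂'} {g₂ : M₂' →ₗ[R₂] M₂''} (h : Function.Exact f₂ g₂)
    (hg : Function.Surjective g₂) :
    Function.Exact (map (D := D) (.id : M₁ →ₗ[R₁] M₁) f₂) (map (.id : M₁ →ₗ[R₁] M₁) g₂) :=
  lTensor_exact M₁ (f := f₂.restrictScalars D) (g := g₂.restrictScalars D) h hg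

variable (M₁ M₂) in
theorem map_exact_id {f₁ : M₁ →ₗ[R₁] M₁'} {g₁ : M₁' →ₗ[R₁] M₁''} (h : Function.Exact f₁ g₁)
    (hg : Function.Surjective g₁) :
    Function.Exact (map (D := D) f₁ (.id : M₂ →ₗ[R₂] M₂)) (map g₁ (.id : M₂ →ₗ[R₂] M₂)) :=
  rTensor_exact M₂ (f := f₁.restrictScalars D) (g := g₁.restrictScalars D) h hg

/-- The canonical map `Hom(M₁, M₁') ⊗_D Hom(M₂, M₂') → Hom(M₁ ⊗_D M₂, M₁' ⊗_D M₂')`. -/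
noncomputable def homMap : OuterTensor D (M₁ →ₗ[R₁] M₁') (M₂ →ₗ[R₂] M₂') →ₗ[R₁ ⊗[D] R₂]
    OuterTensor D M₁ M₂ →ₗ[R₁ ⊗[D] R₂] OuterTensor D M₁' M₂' :=
  lift (AddMonoidHom.mk' (fun f₁ => AddMonoidHom.mk' (fun f₂ => map f₁ f₂)
      fun f₂ f₂' => hom_ext fun m₁ m₂ => tmul_add D (f₁ m₁) (f₂ m₂) (f₂' m₂))
      fun f₁ f₁' => AddMonoidHom.ext fun f₂ =>
        hom_ext fun m₁ m₂ => add_tmul D (f₁ m₁) (f₁' m₁) (f₂ m₂))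
    fun _ _ _ _ => hom_ext fun _ _ => rfl

@[simp]
theorem homMap_tmul (f₁ : M₁ →ₗ[R₁] M₁') (f₂ : M₂ →ₗ[R₂] M₂') :
    homMap (tmul D f₁ f₂) = map f₁ f₂ :=
  rfl

-- Unlike `map_id_exact`, this applies to the left exact sequences produced by Hom, whose last map
-- need not be surjective.
variable (M₁ M₂) in
theorem map_id_exact_of_flat [Module.Flat D M₁] {f₂ : M₂ →ₗ[R₂] M₂'} {g₂ : M₂' →ₗ[R₂] M₂''}
    (h : Function.Exact f₂ g₂) :
    Function.Exact (map (D := D) (.id : M₁ →ₗ[R₁] M₁) f₂) (map (.id : M₁ →ₗ[R₁] M₁) g₂) :=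
  Module.Flat.lTensor_exact M₁ (f := f₂.restrictScalars D) (g := g₂.restrictScalars D) h

variable (M₁ M₂) in
theorem map_exact_id_of_flat [Module.Flat D M₂] {f₁ : M₁ →ₗ[R₁] M₁'} {g₁ : M₁' →ₗ[R₁] M₁''}
    (h : Function.Exact f₁ g₁) :
    Function.Exact (map (D := D) f₁ (.id : M₂ →ₗ[R₂] M₂)) (map g₁ (.id : M₂ →ₗ[R₂] M₂)) :=
  Module.Flat.rTensor_exact M₂ (f := f₁.restrictScalars D) (g := g₁.restrictScalars D) h

end OuterTensor

/-! ### Homomorphisms between outer tensor products -/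

theorem Module.Finite.exists_dualBasis_of_projective (R M : Type*) [CommRing R] [AddCommGroup M]
    [Module R M] [Module.Finite R M] [Module.Projective R M] :
    ∃ (n : ℕ) (φ : Fin n → M →ₗ[R] R) (a : Fin n → M),
      ∑ j, LinearMap.smulRight (φ j) (a j) = LinearMap.id := by
  obtain ⟨n, f, g, -, -, hfg⟩ := Module.Finite.exists_comp_eq_id_of_projective R M
  refine ⟨n, fun j => LinearMap.proj j ∘ₗ g, fun j => f (Pi.single j 1), LinearMap.ext fun x => ?_⟩
  have h := LinearMap.congr_fun hfg x
  simp only [LinearMap.comp_apply, LinearMap.id_apply] at h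
  rw [LinearMap.id_apply]
  conv_rhs => rw [← h, pi_eq_sum_univ' (g x), map_sum]
  rw [LinearMap.sum_apply]
  exact Finset.sum_congr rfl fun j _ => by rw [map_smul]; rfl

theorem LinearMap.sum_smulRight_apply {R M N ι : Type*} [CommRing R] [AddCommGroup M]
    [Module R M] [AddCommGroup N] [Module R N] [Fintype ι] {φ : ι → M →ₗ[R] R} {a : ι → M}
    (h : ∑ j, LinearMap.smulRight (φ j) (a j) = LinearMap.id) (f : M →ₗ[R] N) :
    ∑ j, LinearMap.smulRight (φ j) (f (a j)) = f := by
  ext x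
  have := congrArg f (LinearMap.congr_fun h x)
  simpa [LinearMap.sum_apply, map_sum] using this

theorem Function.Exact.lcomp {R M M' M'' : Type*} (N : Type*) [CommRing R] [AddCommGroup M]
    [Module R M] [AddCommGroup M'] [Module R M'] [AddCommGroup M''] [Module R M'']
    [AddCommGroup N] [Module R N] {α : M →ₗ[R] M'} {β : M' →ₗ[R] M''} (h : Function.Exact α β)
    (hβ : Function.Surjective β) :
    Function.Exact (LinearMap.lcomp R N β) (LinearMap.lcomp R N α) :=
  LinearMap.exact_lcomp_of_exact_of_surjective N h hβ

namespace OuterTensor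

variable {D R₁ R₂ : Type u} [CommRing D] [CommRing R₁] [CommRing R₂] [Algebra D R₁] [Algebra D R₂]
  {M₁ M₂ N₁ N₂ F₁ F₂ F₁' F₂' : Type u}
  [AddCommGroup M₁] [Module D M₁] [Module R₁ M₁] [IsScalarTower D R₁ M₁]
  [AddCommGroup M₂] [Module D M₂] [Module R₂ M₂] [IsScalarTower D R₂ M₂]
  [AddCommGroup N₁] [Module D N₁] [Module R₁ N₁] [IsScalarTower D R₁ N₁]
  [AddCommGroup N₂] [Module D N₂] [Module R₂ N₂] [IsScalarTower D R₂ N₂]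
  [AddCommGroup F₁] [Module D F₁] [Module R₁ F₁] [IsScalarTower D R₁ F₁]
  [AddCommGroup F₂] [Module D F₂] [Module R₂ F₂] [IsScalarTower D R₂ F₂]
  [AddCommGroup F₁'] [Module D F₁'] [Module R₁ F₁'] [IsScalarTower D R₁ F₁']
  [AddCommGroup F₂'] [Module D F₂'] [Module R₂ F₂'] [IsScalarTower D R₂ F₂']

/-- Needed for arbitrary `z`, since a homomorphism need not take pure tensors to pure tensors. -/
theorem homMap_map_smulRight (φ : M₁ →ₗ[R₁] R₁) (ψ : M₂ →ₗ[R₂] R₂) (z : OuterTensor D N₁ N₂)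
    (x : M₁) (y : M₂) :
    homMap (map (LinearMap.smulRightₗ φ) (LinearMap.smulRightₗ ψ) z) (tmul D x y) =
      (φ x ⊗ₜ[D] ψ y) • z := by
  induction z using OuterTensor.induction with
  | zero => simp
  | tmul m₁ m₂ => rfl
  | add u v hu hv => rw [map_add, map_add, LinearMap.add_apply, hu, hv, smul_add]

theorem homMap_bijective_of_projective [Module.Finite R₁ M₁] [Module.Projective R₁ M₁]
    [Module.Finite R₂ M₂] [Module.Projective R₂ M₂] :
    Function.Bijective (homMap (D := D) (R₁ := R₁) (R₂ := R₂) (M₁ := M₁) (M₂ := M₂)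
      (M₁' := N₁) (M₂' := N₂)) := by
  obtain ⟨n, φ, a, ha⟩ := Module.Finite.exists_dualBasis_of_projective R₁ M₁
  obtain ⟨m, ψ, b, hb⟩ := Module.Finite.exists_dualBasis_of_projective R₂ M₂
  -- The inverse rebuilds `h` from its values on products of the dual basis elements: `Ψ h` is the
  -- sum of the `φ i ⊗ ψ j` with coefficient `h (a i ⊗ b j)`.
  let Ψ : (OuterTensor D M₁ M₂ →ₗ[R₁ ⊗[D] R₂] OuterTensor D N₁ N₂) →ₗ[R₁ ⊗[D] R₂]
      OuterTensor D (M₁ →ₗ[R₁] N₁) (M₂ →ₗ[R₂] N₂) :=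
    ∑ i, ∑ j, map (LinearMap.smulRightₗ (φ i)) (LinearMap.smulRightₗ (ψ j)) ∘ₗ
      LinearMap.applyₗ (tmul D (a i) (b j))
  refine Function.bijective_iff_has_inverse.2 ⟨Ψ, fun z => ?_, fun h => ?_⟩
  · suffices Ψ ∘ₗ homMap = LinearMap.id from LinearMap.congr_fun this z
    refine hom_ext fun f g => ?_
    simp only [LinearMap.comp_apply, homMap_tmul, Ψ, LinearMap.sum_apply, LinearMap.applyₗ_apply_apply,
      map_tmul, LinearMap.id_apply]
    simp_rw [← tmul_sum, ← sum_tmul]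
    exact congrArg₂ _ (LinearMap.sum_smulRight_apply ha f) (LinearMap.sum_smulRight_apply hb g)
  · refine hom_ext fun x y => ?_
    simp only [Ψ, LinearMap.sum_apply, LinearMap.comp_apply, LinearMap.applyₗ_apply_apply, map_sum,
      homMap_map_smulRight, ← map_smul, smul_tmul]
    simp_rw [← map_sum, ← tmul_sum, ← sum_tmul]
    have hx := LinearMap.congr_fun ha x
    have hy := LinearMap.congr_fun hb y
    simp only [LinearMap.sum_apply, LinearMap.smulRight_apply, LinearMap.id_apply] at hx hy
    rw [hx, hy]

-- Naturality of `homMap` in the sources; it supplies the commuting squares for the five lemma.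
variable (N₁ N₂) in
theorem homMap_comp_map (α : M₁ →ₗ[R₁] F₁) (β : M₂ →ₗ[R₂] F₂) :
    LinearMap.lcomp (R₁ ⊗[D] R₂) (OuterTensor D N₁ N₂) (map α β) ∘ₗ homMap =
      homMap ∘ₗ map (LinearMap.lcomp R₁ N₁ α) (LinearMap.lcomp R₂ N₂ β) :=
  hom_ext fun _ _ => hom_ext fun _ _ => rfl

/-- Five lemma for two left exact rows. The upper one is `Hom(-, N₁)` of the presentation tensored
with the flat module `Hom(M₂, N₂)`. The lower one is Hom out of the presentation tensored with `M₂`,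
where right exactness of the tensor product suffices, so `M₂` need not be flat. -/
theorem homMap_bijective_of_presentation_left [Module.Flat D (M₂ →ₗ[R₂] N₂)]
    {α : F₁' →ₗ[R₁] F₁} {β : F₁ →ₗ[R₁] M₁} (h : Function.Exact α β) (hβ : Function.Surjective β)
    (h₁ : Function.Bijective (homMap (D := D) (R₁ := R₁) (R₂ := R₂) (M₁ := F₁) (M₂ := M₂)
      (M₁' := N₁) (M₂' := N₂)))
    (h₂ : Function.Injective (homMap (D := D) (R₁ := R₁) (R₂ := R₂) (M₁ := F₁') (M₂ := M₂)
      (M₁' := N₁) (M₂' := N₂))) :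
    Function.Bijective (homMap (D := D) (R₁ := R₁) (R₂ := R₂) (M₁ := M₁) (M₂ := M₂)
      (M₁' := N₁) (M₂' := N₂)) :=
  LinearMap.bijective_of_bijective_of_injective_of_left_exact
    (map (LinearMap.lcomp R₁ N₁ β) .id) (map (LinearMap.lcomp R₁ N₁ α) .id)
    (LinearMap.lcomp _ _ (map β .id)) (LinearMap.lcomp _ _ (map α .id)) homMap homMap homMap
    (homMap_comp_map N₁ N₂ β .id) (homMap_comp_map N₁ N₂ α .id)
    (map_exact_id_of_flat _ _ (h.lcomp N₁ hβ))
    ((map_exact_id _ _ h hβ).lcomp _ (map_surjective hβ Function.surjective_id)) h₁ h₂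
    (map_injective_id (LinearMap.lcomp_injective_of_surjective _ hβ))
    (LinearMap.lcomp_injective_of_surjective _ (map_surjective hβ Function.surjective_id))

theorem homMap_bijective_of_presentation_right [Module.Flat D (M₁ →ₗ[R₁] N₁)]
    {α : F₂' →ₗ[R₂] F₂} {β : F₂ →ₗ[R₂] M₂} (h : Function.Exact α β) (hβ : Function.Surjective β)
    (h₁ : Function.Bijective (homMap (D := D) (R₁ := R₁) (R₂ := R₂) (M₁ := M₁) (M₂ := F₂)
      (M₁' := N₁) (M₂' := N₂)))
    (h₂ : Function.Injective (homMap (D := D) (R₁ := R₁) (R₂ := R₂) (M₁ := M₁) (M₂ := F₂')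
      (M₁' := N₁) (M₂' := N₂))) :
    Function.Bijective (homMap (D := D) (R₁ := R₁) (R₂ := R₂) (M₁ := M₁) (M₂ := M₂)
      (M₁' := N₁) (M₂' := N₂)) :=
  LinearMap.bijective_of_bijective_of_injective_of_left_exact
    (map .id (LinearMap.lcomp R₂ N₂ β)) (map .id (LinearMap.lcomp R₂ N₂ α))
    (LinearMap.lcomp _ _ (map .id β)) (LinearMap.lcomp _ _ (map .id α)) homMap homMap homMap
    (homMap_comp_map N₁ N₂ .id β) (homMap_comp_map N₁ N₂ .id α)
    (map_id_exact_of_flat _ _ (h.lcomp N₂ hβ))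
    ((map_id_exact _ _ h hβ).lcomp _ (map_surjective Function.surjective_id hβ)) h₁ h₂
    (map_id_injective (LinearMap.lcomp_injective_of_surjective _ hβ))
    (LinearMap.lcomp_injective_of_surjective _ (map_surjective Function.surjective_id hβ))

end OuterTensor

theorem Module.Finite.exists_presentation (R M : Type*) [CommRing R] [IsNoetherianRing R]
    [AddCommGroup M] [Module R M] [Module.Finite R M] :
    ∃ (m n : ℕ) (α : (Fin m → R) →ₗ[R] Fin n → R) (β : (Fin n → R) →ₗ[R] M),
      Function.Exact α β ∧ Function.Surjective β := by
  obtain ⟨n, β, hβ⟩ := Module.Finite.exists_fin' R M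
  obtain ⟨m, γ, hγ⟩ := Module.Finite.exists_fin' R (LinearMap.ker β)
  refine ⟨m, n, (LinearMap.ker β).subtype ∘ₗ γ, β, ?_, hβ⟩
  rw [LinearMap.exact_iff, LinearMap.range_comp, LinearMap.range_eq_top.2 hγ, Submodule.map_top,
    Submodule.range_subtype]

namespace OuterTensor

variable {D R₁ R₂ : Type u} [CommRing D] [IsDomain D] [IsPrincipalIdealRing D] [CommRing R₁]
  [IsDomain R₁] [IsNoetherianRing R₁] [CommRing R₂] [IsDomain R₂] [IsNoetherianRing R₂]
  [Algebra D R₁] [Algebra D R₂]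
  {M₁ M₂ N₁ N₂ : Type u}
  [AddCommGroup M₁] [Module D M₁] [Module R₁ M₁] [IsScalarTower D R₁ M₁]
  [AddCommGroup M₂] [Module D M₂] [Module R₂ M₂] [IsScalarTower D R₂ M₂]
  [AddCommGroup N₁] [Module D N₁] [Module R₁ N₁] [IsScalarTower D R₁ N₁]
  [AddCommGroup N₂] [Module D N₂] [Module R₂ N₂] [IsScalarTower D R₂ N₂]

theorem homMap_bijective (hf₁ : Function.Injective (algebraMap D R₁))
    (hf₂ : Function.Injective (algebraMap D R₂)) [Module.Finite R₁ M₁] [Module.Finite R₂ M₂]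
    [Module.IsTorsionFree R₁ N₁] [Module.IsTorsionFree R₂ N₂] :
    Function.Bijective (homMap (D := D) (R₁ := R₁) (R₂ := R₂) (M₁ := M₁) (M₂ := M₂)
      (M₁' := N₁) (M₂' := N₂)) := by
  have flat₁ : Module.Flat D (M₁ →ₗ[R₁] N₁) :=
    have := Module.IsTorsionFree.linearMap R₁ M₁ N₁
    Module.IsTorsionFree.flat_of_injective _ hf₁
  have flat₂ (n : ℕ) : Module.Flat D ((Fin n → R₂) →ₗ[R₂] N₂) :=
    have := Module.IsTorsionFree.linearMap R₂ (Fin n → R₂) N₂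
    Module.IsTorsionFree.flat_of_injective _ hf₂
  obtain ⟨m₁, n₁, α₁, β₁, h₁, hβ₁⟩ := Module.Finite.exists_presentation R₁ M₁
  obtain ⟨m₂, n₂, α₂, β₂, h₂, hβ₂⟩ := Module.Finite.exists_presentation R₂ M₂
  -- The first factor is resolved while the second is free, using flatness of `Hom(R₂ⁿ, N₂)`; the
  -- second is then resolved using flatness of `Hom(M₁, N₁)`.
  have aux (n : ℕ) : Function.Bijective (homMap (D := D) (R₁ := R₁) (R₂ := R₂) (M₁ := M₁)
      (M₂ := Fin n → R₂) (M₁' := N₁) (M₂' := N₂)) :=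
    homMap_bijective_of_presentation_left h₁ hβ₁ homMap_bijective_of_projective
      homMap_bijective_of_projective.1
  exact homMap_bijective_of_presentation_right h₂ hβ₂ (aux n₂) (aux m₂).1

end OuterTensor

/-! ### Vanishing of `Ext` between outer tensor products -/

namespace OuterTensor

variable {D R₁ R₂ : Type u} [CommRing D] [CommRing R₁] [CommRing R₂] [Algebra D R₁] [Algebra D R₂]
  {M₁ M₂ N₁ N₂ K F : Type u}
  [AddCommGroup M₁] [Module D M₁] [Module R₁ M₁] [IsScalarTower D R₁ M₁]
  [AddCommGroup M₂] [Module D M₂] [Module R₂ M₂] [IsScalarTower D R₂ M₂]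
  [AddCommGroup N₁] [Module D N₁] [Module R₁ N₁] [IsScalarTower D R₁ N₁]
  [AddCommGroup N₂] [Module D N₂] [Module R₂ N₂] [IsScalarTower D R₂ N₂]

/-- Products of the two dual bases form a dual basis. The summand form feeds directly into
`ExtPosVanish.of_summand`. -/
theorem isSummandOfPower_of_projective [Module.Finite R₁ M₁] [Module.Projective R₁ M₁]
    [Module.Finite R₂ M₂] [Module.Projective R₂ M₂] :
    IsSummandOfPower (R₁ ⊗[D] R₂) (OuterTensor D M₁ M₂) (R₁ ⊗[D] R₂) := by
  obtain ⟨n, φ, a, ha⟩ := Module.Finite.exists_dualBasis_of_projective R₁ M₁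
  obtain ⟨m, ψ, b, hb⟩ := Module.Finite.exists_dualBasis_of_projective R₂ M₂
  let e := ringEquiv D R₁ R₂
  let s := (finProdFinEquiv (m := n) (n := m)).symm
  refine ⟨n * m, fun k => e.toLinearMap ∘ₗ map (φ (s k).1) (ψ (s k).2),
    fun k => map (LinearMap.toSpanSingleton R₁ M₁ (a (s k).1))
      (LinearMap.toSpanSingleton R₂ M₂ (b (s k).2)) ∘ₗ e.symm.toLinearMap, ?_⟩
  rw [s.sum_comp (fun k => (map (LinearMap.toSpanSingleton R₁ M₁ (a k.1))
      (LinearMap.toSpanSingleton R₂ M₂ (b k.2)) ∘ₗ e.symm.toLinearMap) ∘ₗ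
        e.toLinearMap ∘ₗ map (φ k.1) (ψ k.2)), Fintype.sum_prod_type]
  refine hom_ext fun x y => ?_
  simp only [LinearMap.sum_apply, LinearMap.comp_apply, LinearEquiv.coe_coe,
    LinearEquiv.symm_apply_apply, map_tmul, LinearMap.toSpanSingleton_apply, LinearMap.id_apply]
  simp_rw [← tmul_sum, ← sum_tmul]
  have hx := LinearMap.congr_fun ha x
  have hy := LinearMap.congr_fun hb y
  simp only [LinearMap.sum_apply, LinearMap.smulRight_apply, LinearMap.id_apply] at hx hy
  rw [hx, hy]

theorem finite [Module.Finite R₁ M₁] [Module.Finite R₂ M₂] :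
    Module.Finite (R₁ ⊗[D] R₂) (OuterTensor D M₁ M₂) := by
  obtain ⟨m, α, hα⟩ := Module.Finite.exists_fin' R₁ M₁
  obtain ⟨n, β, hβ⟩ := Module.Finite.exists_fin' R₂ M₂
  obtain ⟨k, f, g, hfg⟩ := isSummandOfPower_of_projective (D := D) (R₁ := R₁) (R₂ := R₂)
    (M₁ := Fin m → R₁) (M₂ := Fin n → R₂)
  have : Module.Finite (R₁ ⊗[D] R₂) (OuterTensor D (Fin m → R₁) (Fin n → R₂)) := by
    refine .of_surjective (LinearMap.lsum (R₁ ⊗[D] R₂) (fun _ : Fin k => R₁ ⊗[D] R₂) ℕ g)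
      fun x => ⟨fun j => f j x, ?_⟩
    have := LinearMap.congr_fun hfg x
    simpa [LinearMap.sum_apply] using this
  exact .of_surjective _ (map_surjective (D := D) hα hβ)

variable [AddCommGroup K] [Module D K] [AddCommGroup F] [Module D F]

/-- Under `homMap`, restriction along `map ι .id` corresponds to restriction along `ι` tensored with
an identity, and tensoring preserves surjectivity. -/
theorem exists_extension_left [Module R₁ K] [IsScalarTower D R₁ K] [Module R₁ F]
    [IsScalarTower D R₁ F]
    (hK : Function.Surjective (homMap (D := D) (R₁ := R₁) (R₂ := R₂) (M₁ := K) (M₂ := M₂)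
      (M₁' := N₁) (M₂' := N₂)))
    {ι : K →ₗ[R₁] F} (hι : ∀ k : K →ₗ[R₁] N₁, ∃ p : F →ₗ[R₁] N₁, p ∘ₗ ι = k)
    (k : OuterTensor D K M₂ →ₗ[R₁ ⊗[D] R₂] OuterTensor D N₁ N₂) :
    ∃ p : OuterTensor D F M₂ →ₗ[R₁ ⊗[D] R₂] OuterTensor D N₁ N₂, p ∘ₗ map ι .id = k := by
  obtain ⟨z, rfl⟩ := hK k
  obtain ⟨w, rfl⟩ := map_surjective (D := D) (f₁ := LinearMap.lcomp R₁ N₁ ι)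
    (f₂ := (.id : (M₂ →ₗ[R₂] N₂) →ₗ[R₂] _)) hι Function.surjective_id z
  exact ⟨homMap w, LinearMap.congr_fun (homMap_comp_map N₁ N₂ ι .id) w⟩

theorem exists_extension_right [Module R₂ K] [IsScalarTower D R₂ K] [Module R₂ F]
    [IsScalarTower D R₂ F]
    (hK : Function.Surjective (homMap (D := D) (R₁ := R₁) (R₂ := R₂) (M₁ := M₁) (M₂ := K)
      (M₁' := N₁) (M₂' := N₂)))
    {ι : K →ₗ[R₂] F} (hι : ∀ k : K →ₗ[R₂] N₂, ∃ p : F →ₗ[R₂] N₂, p ∘ₗ ι = k)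
    (k : OuterTensor D M₁ K →ₗ[R₁ ⊗[D] R₂] OuterTensor D N₁ N₂) :
    ∃ p : OuterTensor D M₁ F →ₗ[R₁ ⊗[D] R₂] OuterTensor D N₁ N₂, p ∘ₗ map .id ι = k := by
  obtain ⟨z, rfl⟩ := hK k
  obtain ⟨w, rfl⟩ := map_surjective (D := D) (f₂ := LinearMap.lcomp R₂ N₂ ι)
    (f₁ := (.id : (M₁ →ₗ[R₁] N₁) →ₗ[R₁] _)) Function.surjective_id hι z
  exact ⟨homMap w, LinearMap.congr_fun (homMap_comp_map N₁ N₂ .id ι) w⟩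

end OuterTensor

theorem ExtPosVanish.of_succ {R M N : Type u} [CommRing R] [AddCommGroup M] [Module R M]
    [AddCommGroup N] [Module R N]
    (h : ∀ n, Subsingleton (Ext (ModuleCat.of R M) (ModuleCat.of R N) (n + 1))) :
    ExtPosVanish R M N := by
  rintro (_ | n) hn
  · omega
  · exact h n

namespace OuterTensor

variable {D R₁ R₂ : Type u} [CommRing D] [IsDomain D] [IsPrincipalIdealRing D] [CommRing R₁]
  [IsDomain R₁] [IsNoetherianRing R₁] [CommRing R₂] [IsDomain R₂] [IsNoetherianRing R₂]
  [Algebra D R₁] [Algebra D R₂]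

/-- Tensoring `0 → K → R₁ᵃ → M₁ → 0` with the flat module `M₂` keeps it exact, and `hP` makes the
middle term acyclic. Degree one follows from `exists_extension_left`, higher degrees from the syzygy
`K`. `M₁` is quantified after `n` because the induction replaces it by `K`. -/
theorem subsingleton_ext_left (hf₁ : Function.Injective (algebraMap D R₁))
    (hf₂ : Function.Injective (algebraMap D R₂)) (M₂ N₁ N₂ : Type u)
    [AddCommGroup M₂] [Module D M₂] [Module R₂ M₂] [IsScalarTower D R₂ M₂]
    [AddCommGroup N₁] [Module D N₁] [Module R₁ N₁] [IsScalarTower D R₁ N₁]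
    [AddCommGroup N₂] [Module D N₂] [Module R₂ N₂] [IsScalarTower D R₂ N₂]
    [Module.Finite R₂ M₂] [Module.Flat D M₂] [Module.IsTorsionFree R₁ N₁]
    [Module.IsTorsionFree R₂ N₂]
    (hP : ∀ a : ℕ, ExtPosVanish (R₁ ⊗[D] R₂) (OuterTensor D (Fin a → R₁) M₂)
      (OuterTensor D N₁ N₂)) (n : ℕ) :
    ∀ (M₁ : Type u) [AddCommGroup M₁] [Module D M₁] [Module R₁ M₁] [IsScalarTower D R₁ M₁]
      [Module.Finite R₁ M₁], ExtPosVanish R₁ M₁ N₁ →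
      Subsingleton (Ext (ModuleCat.of (R₁ ⊗[D] R₂) (OuterTensor D M₁ M₂))
        (ModuleCat.of (R₁ ⊗[D] R₂) (OuterTensor D N₁ N₂)) (n + 1)) := by
  induction n with
  | zero =>
    intro M₁ _ _ _ _ _ h
    obtain ⟨a, β, hβ⟩ := Module.Finite.exists_fin' R₁ M₁
    have hex := β.exact_subtype_ker_map
    have hinj := (LinearMap.ker β).injective_subtype
    exact subsingleton_ext_one _ (map_injective_id (M₂ := M₂) hinj) (map_exact_id _ _ hex hβ)
      (map_surjective hβ Function.surjective_id) (hP a 1 le_rfl)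
      (exists_extension_left (homMap_bijective hf₁ hf₂).2 (h.exists_extension N₁ hinj hex hβ))
  | succ n ih =>
    intro M₁ _ _ _ _ _ h
    obtain ⟨a, β, hβ⟩ := Module.Finite.exists_fin' R₁ M₁
    have hex := β.exact_subtype_ker_map
    have hinj := (LinearMap.ker β).injective_subtype
    exact subsingleton_ext_succ _ (map_injective_id (M₂ := M₂) hinj) (map_exact_id _ _ hex hβ)
      (map_surjective hβ Function.surjective_id) (n + 1) (hP a _ (by omega))
      (ih _ (h.kernel N₁ hinj hex hβ (.of_projective _)))

theorem subsingleton_ext_right (hf₁ : Function.Injective (algebraMap D R₁))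
    (hf₂ : Function.Injective (algebraMap D R₂)) (M₁ N₁ N₂ : Type u)
    [AddCommGroup M₁] [Module D M₁] [Module R₁ M₁] [IsScalarTower D R₁ M₁]
    [AddCommGroup N₁] [Module D N₁] [Module R₁ N₁] [IsScalarTower D R₁ N₁]
    [AddCommGroup N₂] [Module D N₂] [Module R₂ N₂] [IsScalarTower D R₂ N₂]
    [Module.Finite R₁ M₁] [Module.Flat D M₁] [Module.IsTorsionFree R₁ N₁]
    [Module.IsTorsionFree R₂ N₂]
    (hP : ∀ a : ℕ, ExtPosVanish (R₁ ⊗[D] R₂) (OuterTensor D M₁ (Fin a → R₂))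
      (OuterTensor D N₁ N₂)) (n : ℕ) :
    ∀ (M₂ : Type u) [AddCommGroup M₂] [Module D M₂] [Module R₂ M₂] [IsScalarTower D R₂ M₂]
      [Module.Finite R₂ M₂], ExtPosVanish R₂ M₂ N₂ →
      Subsingleton (Ext (ModuleCat.of (R₁ ⊗[D] R₂) (OuterTensor D M₁ M₂))
        (ModuleCat.of (R₁ ⊗[D] R₂) (OuterTensor D N₁ N₂)) (n + 1)) := by
  induction n with
  | zero =>
    intro M₂ _ _ _ _ _ h
    obtain ⟨a, β, hβ⟩ := Module.Finite.exists_fin' R₂ M₂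
    have hex := β.exact_subtype_ker_map
    have hinj := (LinearMap.ker β).injective_subtype
    exact subsingleton_ext_one _ (map_id_injective (M₁ := M₁) hinj) (map_id_exact _ _ hex hβ)
      (map_surjective Function.surjective_id hβ) (hP a 1 le_rfl)
      (exists_extension_right (homMap_bijective hf₁ hf₂).2 (h.exists_extension N₂ hinj hex hβ))
  | succ n ih =>
    intro M₂ _ _ _ _ _ h
    obtain ⟨a, β, hβ⟩ := Module.Finite.exists_fin' R₂ M₂
    have hex := β.exact_subtype_ker_map
    have hinj := (LinearMap.ker β).injective_subtype
    exact subsingleton_ext_succ _ (map_id_injective (M₁ := M₁) hinj) (map_id_exact _ _ hex hβ)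
      (map_surjective Function.surjective_id hβ) (n + 1) (hP a _ (by omega))
      (ih _ (h.kernel N₂ hinj hex hβ (.of_projective _)))

variable {M₁ M₂ N₁ N₂ : Type u}
  [AddCommGroup M₁] [Module D M₁] [Module R₁ M₁] [IsScalarTower D R₁ M₁]
  [AddCommGroup M₂] [Module D M₂] [Module R₂ M₂] [IsScalarTower D R₂ M₂]
  [AddCommGroup N₁] [Module D N₁] [Module R₁ N₁] [IsScalarTower D R₁ N₁]
  [AddCommGroup N₂] [Module D N₂] [Module R₂ N₂] [IsScalarTower D R₂ N₂]

theorem extPosVanish (hf₁ : Function.Injective (algebraMap D R₁))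
    (hf₂ : Function.Injective (algebraMap D R₂)) [Module.Finite R₁ M₁] [Module.Finite R₂ M₂]
    [Module.IsTorsionFree R₁ M₁] [Module.IsTorsionFree R₁ N₁] [Module.IsTorsionFree R₂ N₂]
    (h₁ : ExtPosVanish R₁ M₁ N₁) (h₂ : ExtPosVanish R₂ M₂ N₂) :
    ExtPosVanish (R₁ ⊗[D] R₂) (OuterTensor D M₁ M₂) (OuterTensor D N₁ N₂) := by
  have : Module.Flat D M₁ := Module.IsTorsionFree.flat_of_injective M₁ hf₁
  have (a : ℕ) : Module.Flat D (Fin a → R₂) := Module.IsTorsionFree.flat_of_injective _ hf₂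
  -- Shifting in the second factor reduces to `M₁ ⊗_D R₂ᵃ`, and shifting in the first then reduces
  -- to `R₁ᵇ ⊗_D R₂ᵃ`, which is projective.
  refine .of_succ fun n => subsingleton_ext_right hf₁ hf₂ M₁ N₁ N₂ (fun a => .of_succ fun m =>
    subsingleton_ext_left hf₁ hf₂ (Fin a → R₂) N₁ N₂ (fun b => ?_) m M₁ h₁) n M₂ h₂
  exact (ExtPosVanish.of_projective (R := R₁ ⊗[D] R₂) (M := R₁ ⊗[D] R₂) _).of_summand
    isSummandOfPower_of_projective (.of_equiv (.refl _ _))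

/-- The isomorphism `Hom(M₁, N₁) ⊗_D Hom(M₂, N₂) ≅ Hom(M₁ ⊗_D M₂, N₁ ⊗_D N₂)`. -/
noncomputable def homEquiv (hf₁ : Function.Injective (algebraMap D R₁))
    (hf₂ : Function.Injective (algebraMap D R₂)) [Module.Finite R₁ M₁] [Module.Finite R₂ M₂]
    [Module.IsTorsionFree R₁ N₁] [Module.IsTorsionFree R₂ N₂] :
    OuterTensor D (M₁ →ₗ[R₁] N₁) (M₂ →ₗ[R₂] N₂) ≃ₗ[R₁ ⊗[D] R₂]
      OuterTensor D M₁ M₂ →ₗ[R₁ ⊗[D] R₂] OuterTensor D N₁ N₂ :=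
  .ofBijective homMap (homMap_bijective hf₁ hf₂)

/-! ### Transfer of semidualizing and totally reflexive modules to the tensor product -/

theorem isSemidualizing (hf₁ : Function.Injective (algebraMap D R₁))
    (hf₂ : Function.Injective (algebraMap D R₂)) (h₁ : IsSemidualizing R₁ M₁)
    (h₂ : IsSemidualizing R₂ M₂) : IsSemidualizing (R₁ ⊗[D] R₂) (OuterTensor D M₁ M₂) := by
  have := h₁.finite
  have := h₂.finite
  have := h₁.isTorsionFree
  have := h₂.isTorsionFree
  exact ⟨finite, ⟨(homEquiv hf₁ hf₂).symm ≪≫ₗ congr h₁.hom.some h₂.hom.some ≪≫ₗ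
    ringEquiv D R₁ R₂⟩, extPosVanish hf₁ hf₂ h₁.ext h₂.ext⟩

theorem isTotallyReflexive (hf₁ : Function.Injective (algebraMap D R₁))
    (hf₂ : Function.Injective (algebraMap D R₂)) [Module.Finite R₁ M₁] [Module.Finite R₂ M₂]
    [Module.Finite R₁ N₁] [Module.Finite R₂ N₂] [Module.IsTorsionFree R₁ M₁]
    [Module.IsTorsionFree R₁ N₁] [Module.IsTorsionFree R₂ N₂]
    (h₁ : IsTotallyReflexive R₁ N₁ M₁) (h₂ : IsTotallyReflexive R₂ N₂ M₂) :
    IsTotallyReflexive (R₁ ⊗[D] R₂) (OuterTensor D N₁ N₂) (OuterTensor D M₁ M₂) := by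
  -- The dual `Hom(M₁, N₁)` takes the place of `M₁` in `extPosVanish` below, so it too must be
  -- torsion-free.
  have := Module.IsTorsionFree.linearMap R₁ M₁ N₁
  let e := homEquiv (D := D) (M₁ := M₁) (M₂ := M₂) (N₁ := N₁) (N₂ := N₂) hf₁ hf₂
  exact ⟨⟨congr h₁.bidual.some h₂.bidual.some ≪≫ₗ homEquiv hf₁ hf₂ ≪≫ₗ
      LinearEquiv.arrowCongr e (.refl _ _)⟩, extPosVanish hf₁ hf₂ h₁.ext h₂.ext,
    (extPosVanish hf₁ hf₂ h₁.ext_dual h₂.ext_dual).of_summand (.of_equiv e.symm)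
      (.of_equiv (.refl _ _))⟩

end OuterTensor

/-! ### Outer tensor products and tensor products -/

namespace OuterTensor

variable {D R₁ R₂ : Type u} [CommRing D] [CommRing R₁] [CommRing R₂] [Algebra D R₁] [Algebra D R₂]

section

variable (D R₁ R₂) (A₁ A₂ C₁ C₂ : Type u)
  [AddCommGroup A₁] [Module D A₁] [Module R₁ A₁] [IsScalarTower D R₁ A₁]
  [AddCommGroup A₂] [Module D A₂] [Module R₂ A₂] [IsScalarTower D R₂ A₂]
  [AddCommGroup C₁] [Module D C₁] [Module R₁ C₁] [IsScalarTower D R₁ C₁]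
  [AddCommGroup C₂] [Module D C₂] [Module R₂ C₂] [IsScalarTower D R₂ C₂]

/-- For fixed `a₁` and `c₁`, the map `a₂ ⊗ c₂ ↦ (a₁ ⊗ a₂) ⊗ (c₁ ⊗ c₂)`. -/
noncomputable def tensorTensorAux (a₁ : A₁) (c₁ : C₁) :
    A₂ ⊗[R₂] C₂ →+ OuterTensor D A₁ A₂ ⊗[R₁ ⊗[D] R₂] OuterTensor D C₁ C₂ :=
  TensorProduct.liftAddHom
    (AddMonoidHom.mk' (fun a₂ => AddMonoidHom.mk' (fun c₂ => tmul D a₁ a₂ ⊗ₜ tmul D c₁ c₂)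
      fun c₂ c₂' => by rw [tmul_add, TensorProduct.tmul_add])
      fun a₂ a₂' => AddMonoidHom.ext fun c₂ => by
        simp only [AddMonoidHom.mk'_apply, AddMonoidHom.add_apply]
        rw [tmul_add, TensorProduct.add_tmul])
    fun r₂ a₂ c₂ => by
      change tmul D a₁ (r₂ • a₂) ⊗ₜ tmul D c₁ c₂ = tmul D a₁ a₂ ⊗ₜ tmul D c₁ (r₂ • c₂)
      have h₁ : tmul D a₁ (r₂ • a₂) = ((1 : R₁) ⊗ₜ[D] r₂) • tmul D a₁ a₂ := by
        rw [smul_tmul, one_smul]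
      have h₂ : tmul D c₁ (r₂ • c₂) = ((1 : R₁) ⊗ₜ[D] r₂) • tmul D c₁ c₂ := by
        rw [smul_tmul, one_smul]
      rw [h₁, h₂, TensorProduct.smul_tmul]

theorem tensorTensorAux_tmul (a₁ : A₁) (c₁ : C₁) (a₂ : A₂) (c₂ : C₂) :
    tensorTensorAux D R₁ R₂ A₁ A₂ C₁ C₂ a₁ c₁ (a₂ ⊗ₜ c₂) = tmul D a₁ a₂ ⊗ₜ tmul D c₁ c₂ :=
  rfl

theorem addMonoidHom_ext {R M N X : Type*} [CommRing R] [AddCommGroup M] [Module R M]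
    [AddCommGroup N] [Module R N] [AddCommGroup X] {f g : M ⊗[R] N →+ X}
    (h : ∀ m n, f (m ⊗ₜ n) = g (m ⊗ₜ n)) : f = g :=
  AddMonoidHom.ext fun x => by
    induction x using TensorProduct.induction_on with
    | zero => simp
    | tmul m n => exact h m n
    | add x y hx hy => rw [map_add, map_add, hx, hy]

/-- The map `(a₁ ⊗ c₁) ⊗ (a₂ ⊗ c₂) ↦ (a₁ ⊗ a₂) ⊗ (c₁ ⊗ c₂)`. -/
noncomputable def tensorTensorHom : OuterTensor D (A₁ ⊗[R₁] C₁) (A₂ ⊗[R₂] C₂) →ₗ[R₁ ⊗[D] R₂]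
    OuterTensor D A₁ A₂ ⊗[R₁ ⊗[D] R₂] OuterTensor D C₁ C₂ :=
  let F : A₁ ⊗[R₁] C₁ →+ A₂ ⊗[R₂] C₂ →+
      OuterTensor D A₁ A₂ ⊗[R₁ ⊗[D] R₂] OuterTensor D C₁ C₂ :=
    TensorProduct.liftAddHom
      (AddMonoidHom.mk' (fun a₁ => AddMonoidHom.mk'
        (fun c₁ => tensorTensorAux D R₁ R₂ A₁ A₂ C₁ C₂ a₁ c₁)
        fun c₁ c₁' => addMonoidHom_ext fun a₂ c₂ => by
          simp only [AddMonoidHom.add_apply, tensorTensorAux_tmul]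
          rw [add_tmul, TensorProduct.tmul_add])
        fun a₁ a₁' => AddMonoidHom.ext fun c₁ => addMonoidHom_ext fun a₂ c₂ => by
          simp only [AddMonoidHom.mk'_apply, AddMonoidHom.add_apply, tensorTensorAux_tmul]
          rw [add_tmul, TensorProduct.add_tmul])
      fun r₁ a₁ c₁ => addMonoidHom_ext fun a₂ c₂ => by
        simp only [AddMonoidHom.mk'_apply, tensorTensorAux_tmul]
        have h₁ : tmul D (r₁ • a₁) a₂ = (r₁ ⊗ₜ[D] (1 : R₂)) • tmul D a₁ a₂ := by
          rw [smul_tmul, one_smul]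
        have h₂ : tmul D (r₁ • c₁) c₂ = (r₁ ⊗ₜ[D] (1 : R₂)) • tmul D c₁ c₂ := by
          rw [smul_tmul, one_smul]
        rw [h₁, h₂, TensorProduct.smul_tmul]
  have hF (a₁ : A₁) (c₁ : C₁) (a₂ : A₂) (c₂ : C₂) :
      F (a₁ ⊗ₜ c₁) (a₂ ⊗ₜ c₂) = tmul D a₁ a₂ ⊗ₜ tmul D c₁ c₂ := rfl
  lift F fun r₁ r₂ x y => by
    induction x using TensorProduct.induction_on with
    | zero => simp
    | add x x' hx hx' =>
      rw [smul_add, map_add, AddMonoidHom.add_apply, hx, hx', map_add, AddMonoidHom.add_apply,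
        smul_add]
    | tmul a₁ c₁ =>
      induction y using TensorProduct.induction_on with
      | zero => simp
      | add y y' hy hy' => rw [smul_add, map_add, hy, hy', map_add, smul_add]
      | tmul a₂ c₂ =>
        rw [TensorProduct.smul_tmul', TensorProduct.smul_tmul', hF, hF, ← smul_tmul,
          TensorProduct.smul_tmul']

/-- `(A₁ ⊗ C₁) ⊗_D (A₂ ⊗ C₂) ≅ (A₁ ⊗_D A₂) ⊗ (C₁ ⊗_D C₂)`. -/
noncomputable def tensorTensorEquiv :
    OuterTensor D (A₁ ⊗[R₁] C₁) (A₂ ⊗[R₂] C₂) ≃ₗ[R₁ ⊗[D] R₂]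
      OuterTensor D A₁ A₂ ⊗[R₁ ⊗[D] R₂] OuterTensor D C₁ C₂ :=
  let F := tensorTensorHom D R₁ R₂ A₁ A₂ C₁ C₂
  let G : OuterTensor D A₁ A₂ ⊗[R₁ ⊗[D] R₂] OuterTensor D C₁ C₂ →ₗ[R₁ ⊗[D] R₂]
      OuterTensor D (A₁ ⊗[R₁] C₁) (A₂ ⊗[R₂] C₂) :=
    -- Currying `a ↦ (c ↦ a ⊗ c)` in each factor and combining by `homMap` gives the inverse with
    -- bilinearity over `R₁ ⊗[D] R₂` built in.
    TensorProduct.lift (homMap ∘ₗ map (TensorProduct.mk R₁ A₁ C₁) (TensorProduct.mk R₂ A₂ C₂))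
  have hF (a₁ : A₁) (c₁ : C₁) (a₂ : A₂) (c₂ : C₂) :
      F (tmul D (a₁ ⊗ₜ c₁) (a₂ ⊗ₜ c₂)) = tmul D a₁ a₂ ⊗ₜ tmul D c₁ c₂ := rfl
  have hG (a₁ : A₁) (c₁ : C₁) (a₂ : A₂) (c₂ : C₂) :
      G (tmul D a₁ a₂ ⊗ₜ tmul D c₁ c₂) = tmul D (a₁ ⊗ₜ c₁) (a₂ ⊗ₜ c₂) := rfl
  .ofLinearMap F G
    (TensorProduct.ext <| hom_ext fun a₁ a₂ => hom_ext fun c₁ c₂ => by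
      simp only [TensorProduct.mk_apply, LinearMap.comp_apply,
        LinearMap.compr₂ₛₗ_apply, LinearMap.id_apply]
      rw [hG, hF])
    (hom_ext fun x y => by
      rw [LinearMap.comp_apply, LinearMap.id_apply]
      induction x using TensorProduct.induction_on with
      | zero => rw [show tmul D (0 : A₁ ⊗[R₁] C₁) y = 0 from TensorProduct.zero_tmul _ _]; simp
      | add x x' hx hx' => rw [add_tmul, map_add, map_add, hx, hx']
      | tmul a₁ c₁ =>
        induction y using TensorProduct.induction_on with
        | zero =>
          rw [show tmul D (a₁ ⊗ₜ[R₁] c₁) (0 : A₂ ⊗[R₂] C₂) = 0 from TensorProduct.tmul_zero _ _]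
          simp
        | add y y' hy hy' => rw [tmul_add, map_add, map_add, hy, hy']
        | tmul a₂ c₂ => rw [hF, hG])

/-- `A₁ ⊗_D R₂` is the base change of `A₁` to `R₁ ⊗_D R₂`. -/
noncomputable def baseChangeLeftEquiv :
    OuterTensor D A₁ R₂ ≃ₗ[R₁ ⊗[D] R₂] (R₁ ⊗[D] R₂) ⊗[R₁] A₁ :=
  let F : OuterTensor D A₁ R₂ →ₗ[R₁ ⊗[D] R₂] (R₁ ⊗[D] R₂) ⊗[R₁] A₁ :=
    lift (AddMonoidHom.mk' (fun a => AddMonoidHom.mk' (fun r => ((1 : R₁) ⊗ₜ[D] r) ⊗ₜ[R₁] a)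
      fun r r' => by rw [TensorProduct.tmul_add, TensorProduct.add_tmul])
      fun a a' => AddMonoidHom.ext fun r => TensorProduct.tmul_add _ _ _)
      fun r₁ r₂ a r => by
        simp only [AddMonoidHom.mk'_apply]
        rw [← TensorProduct.smul_tmul, TensorProduct.smul_tmul' (r₁ ⊗ₜ[D] r₂),
          TensorProduct.smul_tmul' r₁]
        simp
  -- An additive inverse is enough, since linearity is already carried by `F`.
  let G : (R₁ ⊗[D] R₂) ⊗[R₁] A₁ →+ OuterTensor D A₁ R₂ :=
    TensorProduct.liftAddHom (AddMonoidHom.mk' (fun t => AddMonoidHom.mk'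
      (fun a => t • tmul D a 1) fun a a' => by rw [add_tmul, smul_add])
      fun t t' => AddMonoidHom.ext fun a => add_smul _ _ _)
      fun r t a => by
        simp only [AddMonoidHom.mk'_apply]
        have : tmul D (r • a) (1 : R₂) = (r ⊗ₜ[D] (1 : R₂)) • tmul D a 1 := by
          rw [smul_tmul, one_smul]
        rw [this, smul_smul, Algebra.smul_def, mul_comm]
        rfl
  have hF (a : A₁) (r : R₂) : F (tmul D a r) = ((1 : R₁) ⊗ₜ[D] r) ⊗ₜ[R₁] a := rfl
  have hG (t : R₁ ⊗[D] R₂) (a : A₁) : G (t ⊗ₜ a) = t • tmul D a 1 := rfl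
  { F with
    invFun := G
    left_inv := fun x => by
      change G (F x) = x
      induction x using OuterTensor.induction with
      | zero => simp
      | tmul a r => rw [hF, hG, smul_tmul, one_smul, smul_eq_mul, mul_one]
      | add x y hx hy => rw [map_add, map_add, hx, hy]
    right_inv := fun x => by
      change F (G x) = x
      induction x using TensorProduct.induction_on with
      | zero => simp
      | tmul t a => rw [hG, map_smul, hF, TensorProduct.smul_tmul', smul_eq_mul,
          ← Algebra.TensorProduct.one_def, mul_one]
      | add x y hx hy => rw [map_add, map_add, hx, hy] }

/-- `R₁ ⊗_D A₂` is the base change of `A₂` to `R₁ ⊗_D R₂`. -/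
noncomputable def baseChangeRightEquiv :
    OuterTensor D R₁ A₂ ≃ₗ[R₁ ⊗[D] R₂] (R₁ ⊗[D] R₂) ⊗[R₂] A₂ :=
  let F : OuterTensor D R₁ A₂ →ₗ[R₁ ⊗[D] R₂] (R₁ ⊗[D] R₂) ⊗[R₂] A₂ :=
    lift (AddMonoidHom.mk' (fun r => AddMonoidHom.mk' (fun a => (r ⊗ₜ[D] (1 : R₂)) ⊗ₜ[R₂] a)
      fun a a' => TensorProduct.tmul_add _ _ _)
      fun r r' => AddMonoidHom.ext fun a => by
        simp only [AddMonoidHom.mk'_apply, AddMonoidHom.add_apply]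
        rw [TensorProduct.add_tmul, TensorProduct.add_tmul])
      fun r₁ r₂ r a => by
        simp only [AddMonoidHom.mk'_apply]
        rw [← TensorProduct.smul_tmul, TensorProduct.smul_tmul' (r₁ ⊗ₜ[D] r₂), Algebra.smul_def,
          Algebra.TensorProduct.right_algebraMap_apply]
        simp
  let G : (R₁ ⊗[D] R₂) ⊗[R₂] A₂ →+ OuterTensor D R₁ A₂ :=
    TensorProduct.liftAddHom (AddMonoidHom.mk' (fun t => AddMonoidHom.mk'
      (fun a => t • tmul D 1 a) fun a a' => by rw [tmul_add, smul_add])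
      fun t t' => AddMonoidHom.ext fun a => add_smul _ _ _)
      fun r t a => by
        simp only [AddMonoidHom.mk'_apply]
        have : tmul D (1 : R₁) (r • a) = ((1 : R₁) ⊗ₜ[D] r) • tmul D 1 a := by
          rw [smul_tmul, one_smul]
        rw [this, smul_smul, Algebra.smul_def, mul_comm]
        rfl
  have hF (r : R₁) (a : A₂) : F (tmul D r a) = (r ⊗ₜ[D] (1 : R₂)) ⊗ₜ[R₂] a := rfl
  have hG (t : R₁ ⊗[D] R₂) (a : A₂) : G (t ⊗ₜ a) = t • tmul D 1 a := rfl
  { F with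
    invFun := G
    left_inv := fun x => by
      change G (F x) = x
      induction x using OuterTensor.induction with
      | zero => simp
      | tmul r a => rw [hF, hG, smul_tmul, one_smul, smul_eq_mul, mul_one]
      | add x y hx hy => rw [map_add, map_add, hx, hy]
    right_inv := fun x => by
      change F (G x) = x
      induction x using TensorProduct.induction_on with
      | zero => simp
      | tmul t a => rw [hG, map_smul, hF, TensorProduct.smul_tmul', smul_eq_mul,
          ← Algebra.TensorProduct.one_def, mul_one]
      | add x y hx hy => rw [map_add, map_add, hx, hy] }

/-- `A₁ ⊗_D A₂ ≅ (A₁ ⊗_D R₂) ⊗ (R₁ ⊗_D A₂)`. -/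
noncomputable def tensorEquiv : OuterTensor D A₁ A₂ ≃ₗ[R₁ ⊗[D] R₂]
    OuterTensor D A₁ R₂ ⊗[R₁ ⊗[D] R₂] OuterTensor D R₁ A₂ :=
  -- Insert the unit factors `A₁ ≅ A₁ ⊗ R₁` and `A₂ ≅ R₂ ⊗ A₂`, then interchange the middle terms.
  congr (TensorProduct.rid R₁ A₁).symm (TensorProduct.lid R₂ A₂).symm ≪≫ₗ
    tensorTensorEquiv D R₁ R₂ A₁ R₂ R₁ A₂

/-- The inverse is the outer tensor product of the two duals, by the interchange isomorphism. -/
theorem invertible [Module.Invertible R₁ A₁] [Module.Invertible R₂ A₂] :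
    Module.Invertible (R₁ ⊗[D] R₂) (OuterTensor D A₁ A₂) :=
  .left ((tensorTensorEquiv D R₁ R₂ A₁ A₂ (A₁ →ₗ[R₁] R₁) (A₂ →ₗ[R₂] R₂)).symm ≪≫ₗ
    congr (TensorProduct.comm R₁ _ _ ≪≫ₗ Module.Invertible.linearEquiv R₁ A₁)
      (TensorProduct.comm R₂ _ _ ≪≫ₗ Module.Invertible.linearEquiv R₂ A₂) ≪≫ₗ ringEquiv D R₁ R₂)

end

end OuterTensor

/-! ### The induced maps on semidualizing modules and Picard groups -/

/-- Supplies representatives with a compatible `D`-action, obtained through `algebraMap D R`, so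
that their outer tensor product can be formed. -/
theorem SZero.exists_mk_eq (D : Type u) {R : Type u} [CommRing D] [CommRing R] [Algebra D R]
    (c : SZero R) :
    ∃ (C : Type u) (_ : AddCommGroup C) (_ : Module D C) (_ : Module R C)
      (_ : IsScalarTower D R C) (h : IsSemidualizing R C), SZero.mk C h = c := by
  obtain ⟨C, h⟩ := c
  exact ⟨C, inferInstance, Module.compHom C (algebraMap D R), inferInstance,
    IsScalarTower.of_compHom D R C, h, rfl⟩

theorem CommRing.Pic.exists_mk_eq (D : Type u) {R : Type u} [CommRing D] [CommRing R] [Algebra D R]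
    (a : CommRing.Pic R) :
    ∃ (A : Type u) (_ : AddCommGroup A) (_ : Module D A) (_ : Module R A)
      (_ : IsScalarTower D R A) (_ : Module.Invertible R A), CommRing.Pic.mk R A = a :=
  ⟨a.AsModule, inferInstance, Module.compHom a.AsModule (algebraMap D R), inferInstance,
    IsScalarTower.of_compHom D R a.AsModule, inferInstance, CommRing.Pic.mk_eq_self⟩

theorem CommRing.Pic.mapAlgebra_mk {R : Type u} (S A : Type u) [CommRing R] [CommRing S]
    [Algebra R S] [AddCommGroup A] [Module R A] [Module.Invertible R A] :
    CommRing.Pic.mapAlgebra R S (CommRing.Pic.mk R A) = CommRing.Pic.mk S (S ⊗[R] A) :=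
  CommRing.Pic.mk_eq_mk_iff.2
    ⟨AlgebraTensorModule.congr (.refl S S) (CommRing.Pic.mk.linearEquiv R A)⟩

namespace OuterTensor

section Pic

variable (D R₁ R₂ : Type u) [CommRing D] [CommRing R₁] [CommRing R₂] [Algebra D R₁] [Algebra D R₂]

/-- The homomorphism `([𝔞₁], [𝔞₂]) ↦ [𝔞₁ ⊗_D 𝔞₂]` of Picard groups. -/
noncomputable def picHom :
    CommRing.Pic R₁ × CommRing.Pic R₂ →* CommRing.Pic (R₁ ⊗[D] R₂) :=
  (CommRing.Pic.mapAlgebra R₁ (R₁ ⊗[D] R₂)).coprod (CommRing.Pic.mapAlgebra R₂ (R₁ ⊗[D] R₂))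

variable (A₁ A₂ : Type u)
  [AddCommGroup A₁] [Module D A₁] [Module R₁ A₁] [IsScalarTower D R₁ A₁]
  [AddCommGroup A₂] [Module D A₂] [Module R₂ A₂] [IsScalarTower D R₂ A₂]
  [Module.Invertible (R₁ ⊗[D] R₂) (OuterTensor D A₁ A₂)]

theorem picMk_eq_mul [Module.Invertible (R₁ ⊗[D] R₂) (OuterTensor D A₁ R₂)]
    [Module.Invertible (R₁ ⊗[D] R₂) (OuterTensor D R₁ A₂)] :
    CommRing.Pic.mk (R₁ ⊗[D] R₂) (OuterTensor D A₁ A₂) =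
      CommRing.Pic.mk (R₁ ⊗[D] R₂) (OuterTensor D A₁ R₂) *
        CommRing.Pic.mk (R₁ ⊗[D] R₂) (OuterTensor D R₁ A₂) := by
  rw [← CommRing.Pic.mk_tensor]
  exact CommRing.Pic.mk_eq_mk_iff.2 ⟨tensorEquiv D R₁ R₂ A₁ A₂⟩

variable [Module.Invertible R₁ A₁] [Module.Invertible R₂ A₂]

theorem picMk_eq_baseChange_mul : CommRing.Pic.mk (R₁ ⊗[D] R₂) (OuterTensor D A₁ A₂) =
    CommRing.Pic.mk (R₁ ⊗[D] R₂) ((R₁ ⊗[D] R₂) ⊗[R₁] A₁) *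
      CommRing.Pic.mk (R₁ ⊗[D] R₂) ((R₁ ⊗[D] R₂) ⊗[R₂] A₂) := by
  rw [← CommRing.Pic.mk_tensor]
  exact CommRing.Pic.mk_eq_mk_iff.2 ⟨tensorEquiv D R₁ R₂ A₁ A₂ ≪≫ₗ
    TensorProduct.congr (baseChangeLeftEquiv D R₁ R₂ A₁) (baseChangeRightEquiv D R₁ R₂ A₂)⟩

/-- As `picHom` is assembled from the two base change homomorphisms, multiplicativity is automatic
and this formula is what remains to be proved. -/
theorem picHom_mk : picHom D R₁ R₂ (CommRing.Pic.mk R₁ A₁, CommRing.Pic.mk R₂ A₂) =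
    CommRing.Pic.mk (R₁ ⊗[D] R₂) (OuterTensor D A₁ A₂) := by
  rw [picMk_eq_baseChange_mul, picHom, MonoidHom.coprod_apply, CommRing.Pic.mapAlgebra_mk,
    CommRing.Pic.mapAlgebra_mk]

end Pic

variable {D R₁ R₂ : Type u} [CommRing D] [IsDomain D] [IsPrincipalIdealRing D] [CommRing R₁]
  [IsDomain R₁] [IsNoetherianRing R₁] [CommRing R₂] [IsDomain R₂] [IsNoetherianRing R₂]
  [Algebra D R₁] [Algebra D R₂]
  (hf₁ : Function.Injective (algebraMap D R₁)) (hf₂ : Function.Injective (algebraMap D R₂))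

/-- The map `([C₁], [C₂]) ↦ [C₁ ⊗_D C₂]` on classes of semidualizing modules. -/
noncomputable def sZeroMap (c : SZero R₁ × SZero R₂) : SZero (R₁ ⊗[D] R₂) :=
  letI (C : ModuleCat.{u} R₁) : Module D C := Module.compHom C (algebraMap D R₁)
  letI (C : ModuleCat.{u} R₂) : Module D C := Module.compHom C (algebraMap D R₂)
  have (C : ModuleCat.{u} R₁) : IsScalarTower D R₁ C := .of_compHom D R₁ C
  have (C : ModuleCat.{u} R₂) : IsScalarTower D R₂ C := .of_compHom D R₂ C
  Quotient.map₂
    (fun C₁ C₂ => ⟨ModuleCat.of (R₁ ⊗[D] R₂) (OuterTensor D C₁.1 C₂.1),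
      isSemidualizing hf₁ hf₂ C₁.2 C₂.2⟩)
    (by
      rintro _ _ ⟨e₁⟩ _ _ ⟨e₂⟩
      exact ⟨congr e₁ e₂⟩) c.1 c.2

theorem sZeroMap_mk (C₁ C₂ : Type u)
    [AddCommGroup C₁] [d₁ : Module D C₁] [Module R₁ C₁] [t₁ : IsScalarTower D R₁ C₁]
    [AddCommGroup C₂] [d₂ : Module D C₂] [Module R₂ C₂] [t₂ : IsScalarTower D R₂ C₂]
    (h₁ : IsSemidualizing R₁ C₁) (h₂ : IsSemidualizing R₂ C₂) :
    sZeroMap hf₁ hf₂ (SZero.mk C₁ h₁, SZero.mk C₂ h₂) =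
      SZero.mk (OuterTensor D C₁ C₂) (isSemidualizing hf₁ hf₂ h₁ h₂) :=
  letI i₁ : Module D C₁ := Module.compHom C₁ (algebraMap D R₁)
  letI i₂ : Module D C₂ := Module.compHom C₂ (algebraMap D R₂)
  -- `sZeroMap` puts the `D`-action through `algebraMap` on representatives, while `d₁` and `d₂` are
  -- arbitrary compatible ones. The identities are `Rᵢ`-linear, so `congr` compares the two outer
  -- tensor products.
  Quotient.sound ⟨@congr D R₁ R₂ _ _ _ _ _ C₁ C₂ C₁ C₂ _ i₁ _ (.of_compHom D R₁ C₁) _ i₂ _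
    (.of_compHom D R₂ C₂) _ d₁ _ t₁ _ d₂ _ t₂ (LinearEquiv.refl R₁ C₁) (LinearEquiv.refl R₂ C₂)⟩

theorem sZeroMap_rel (c m : SZero R₁ × SZero R₂) (h₁ : SZero.Rel c.1 m.1)
    (h₂ : SZero.Rel c.2 m.2) : SZero.Rel (sZeroMap hf₁ hf₂ c) (sZeroMap hf₁ hf₂ m) := by
  obtain ⟨c₁, c₂⟩ := c
  obtain ⟨m₁, m₂⟩ := m
  obtain ⟨C₁, _, _, _, _, hC₁, rfl⟩ := SZero.exists_mk_eq D c₁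
  obtain ⟨C₂, _, _, _, _, hC₂, rfl⟩ := SZero.exists_mk_eq D c₂
  obtain ⟨M₁, _, _, _, _, hM₁, rfl⟩ := SZero.exists_mk_eq D m₁
  obtain ⟨M₂, _, _, _, _, hM₂, rfl⟩ := SZero.exists_mk_eq D m₂
  rw [sZeroMap_mk, sZeroMap_mk]
  have := hC₁.finite
  have := hC₂.finite
  have := hM₁.finite
  have := hM₂.finite
  have := hC₁.isTorsionFree
  have := hC₂.isTorsionFree
  have := hM₁.isTorsionFree
  exact isTotallyReflexive hf₁ hf₂ h₁ h₂

theorem sZeroMap_ofPic (a : CommRing.Pic R₁ × CommRing.Pic R₂) :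
    sZeroMap hf₁ hf₂ (SZero.ofPic a.1, SZero.ofPic a.2) = SZero.ofPic (picHom D R₁ R₂ a) := by
  obtain ⟨a₁, a₂⟩ := a
  obtain ⟨A₁, _, _, _, _, _, rfl⟩ := CommRing.Pic.exists_mk_eq D a₁
  obtain ⟨A₂, _, _, _, _, _, rfl⟩ := CommRing.Pic.exists_mk_eq D a₂
  have := invertible D R₁ R₂ A₁ A₂
  rw [SZero.ofPic_mk, SZero.ofPic_mk, sZeroMap_mk, picHom_mk, SZero.ofPic_mk]

theorem sZeroMap_smul (a : CommRing.Pic R₁ × CommRing.Pic R₂) (c : SZero R₁ × SZero R₂) :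
    sZeroMap hf₁ hf₂ (a.1 • c.1, a.2 • c.2) = picHom D R₁ R₂ a • sZeroMap hf₁ hf₂ c := by
  obtain ⟨a₁, a₂⟩ := a
  obtain ⟨c₁, c₂⟩ := c
  obtain ⟨A₁, _, _, _, _, _, rfl⟩ := CommRing.Pic.exists_mk_eq D a₁
  obtain ⟨A₂, _, _, _, _, _, rfl⟩ := CommRing.Pic.exists_mk_eq D a₂
  obtain ⟨C₁, _, _, _, _, h₁, rfl⟩ := SZero.exists_mk_eq D c₁
  obtain ⟨C₂, _, _, _, _, h₂, rfl⟩ := SZero.exists_mk_eq D c₂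
  have := invertible D R₁ R₂ A₁ A₂
  rw [SZero.mk_smul_mk, SZero.mk_smul_mk, sZeroMap_mk, sZeroMap_mk, picHom_mk, SZero.mk_smul_mk]
  exact SZero.mk_eq_mk_iff.2 ⟨tensorTensorEquiv D R₁ R₂ A₁ A₂ C₁ C₂⟩

/-- The map induced by `sZeroMap` on orbit spaces. -/
noncomputable def sZeroBarMap (c : SZeroBar R₁ × SZeroBar R₂) : SZeroBar (R₁ ⊗[D] R₂) :=
  Quotient.map₂ (fun c₁ c₂ => sZeroMap hf₁ hf₂ (c₁, c₂))
    (by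
      rintro _ c₁ ⟨a₁, rfl⟩ _ c₂ ⟨a₂, rfl⟩
      -- Equivariance exhibits the Picard element that links the two images.
      exact ⟨picHom D R₁ R₂ (a₁, a₂), (sZeroMap_smul hf₁ hf₂ (a₁, a₂) (c₁, c₂)).symm⟩) c.1 c.2

theorem sZeroBarMap_mk (c : SZero R₁ × SZero R₂) :
    sZeroBarMap hf₁ hf₂ (SZeroBar.mk c.1, SZeroBar.mk c.2) = SZeroBar.mk (sZeroMap hf₁ hf₂ c) :=
  rfl

theorem sZeroBarMap_rel (c m : SZeroBar R₁ × SZeroBar R₂) (h₁ : SZeroBar.Rel c.1 m.1)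
    (h₂ : SZeroBar.Rel c.2 m.2) :
    SZeroBar.Rel (sZeroBarMap hf₁ hf₂ c) (sZeroBarMap hf₁ hf₂ m) := by
  obtain ⟨⟨c₁⟩, ⟨c₂⟩⟩ := c
  obtain ⟨⟨m₁⟩, ⟨m₂⟩⟩ := m
  exact sZeroMap_rel hf₁ hf₂ (c₁, c₂) (m₁, m₂) h₁ h₂

end OuterTensor

theorem proposition3p4 {D R₁ R₂ : Type u}
    [CommRing D] [IsDomain D] [IsPrincipalIdealRing D]
    [CommRing R₁] [IsDomain R₁] [IsNoetherianRing R₁]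
    [CommRing R₂] [IsDomain R₂] [IsNoetherianRing R₂]
    [Algebra D R₁] [Algebra D R₂]
    (hf₁ : Function.Injective (algebraMap D R₁)) (hf₂ : Function.Injective (algebraMap D R₂))
    [IsNoetherianRing (R₁ ⊗[D] R₂)] :
    ∃ (φ : SZero R₁ × SZero R₂ → SZero (R₁ ⊗[D] R₂))
      (ψ : CommRing.Pic R₁ × CommRing.Pic R₂ →* CommRing.Pic (R₁ ⊗[D] R₂))
      (φbar : SZeroBar R₁ × SZeroBar R₂ → SZeroBar (R₁ ⊗[D] R₂)),
      -- `φ` is the well-defined, relation-respecting map `([C₁], [C₂]) ↦ [C₁ ⊗_D C₂]`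
      (∀ (C₁ C₂ : Type u) [AddCommGroup C₁] [AddCommGroup C₂] [Module R₁ C₁] [Module R₂ C₂]
        [Module D C₁] [Module D C₂] [IsScalarTower D R₁ C₁] [IsScalarTower D R₂ C₂]
        (h₁ : IsSemidualizing R₁ C₁) (h₂ : IsSemidualizing R₂ C₂),
        ∃ h : IsSemidualizing (R₁ ⊗[D] R₂) (OuterTensor D C₁ C₂),
          φ (SZero.mk C₁ h₁, SZero.mk C₂ h₂) = SZero.mk (OuterTensor D C₁ C₂) h) ∧
      (∀ c m : SZero R₁ × SZero R₂, SZero.Rel c.1 m.1 → SZero.Rel c.2 m.2 →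
        SZero.Rel (φ c) (φ m)) ∧
      -- (a) `φ` restricts to the group homomorphism `ψ` on Picard groups
      (∀ a : CommRing.Pic R₁ × CommRing.Pic R₂,
        φ (SZero.ofPic a.1, SZero.ofPic a.2) = SZero.ofPic (ψ a)) ∧
      (∀ (A₁ A₂ : Type u) [AddCommGroup A₁] [AddCommGroup A₂] [Module R₁ A₁] [Module R₂ A₂]
        [Module D A₁] [Module D A₂] [IsScalarTower D R₁ A₁] [IsScalarTower D R₂ A₂]
        [Module.Invertible R₁ A₁] [Module.Invertible R₂ A₂],
        ∃ (_ : Module.Invertible (R₁ ⊗[D] R₂) (OuterTensor D A₁ A₂))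
          (_ : Module.Invertible (R₁ ⊗[D] R₂) (OuterTensor D A₁ R₂))
          (_ : Module.Invertible (R₁ ⊗[D] R₂) (OuterTensor D R₁ A₂)),
          ψ (CommRing.Pic.mk R₁ A₁, CommRing.Pic.mk R₂ A₂) =
            CommRing.Pic.mk (R₁ ⊗[D] R₂) (OuterTensor D A₁ A₂) ∧
          CommRing.Pic.mk (R₁ ⊗[D] R₂) (OuterTensor D A₁ A₂) =
            CommRing.Pic.mk (R₁ ⊗[D] R₂) ((R₁ ⊗[D] R₂) ⊗[R₁] A₁) *
              CommRing.Pic.mk (R₁ ⊗[D] R₂) ((R₁ ⊗[D] R₂) ⊗[R₂] A₂) ∧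
          CommRing.Pic.mk (R₁ ⊗[D] R₂) (OuterTensor D A₁ A₂) =
            CommRing.Pic.mk (R₁ ⊗[D] R₂) (OuterTensor D A₁ R₂) *
              CommRing.Pic.mk (R₁ ⊗[D] R₂) (OuterTensor D R₁ A₂)) ∧
      -- (b) `φ` is equivariant along `ψ`
      (∀ (a : CommRing.Pic R₁ × CommRing.Pic R₂) (c : SZero R₁ × SZero R₂),
        φ (a.1 • c.1, a.2 • c.2) = ψ a • φ c) ∧
      -- (c) `φ` descends to the relation-respecting map `φbar` on orbit spaces
      (∀ c : SZero R₁ × SZero R₂,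
        φbar (SZeroBar.mk c.1, SZeroBar.mk c.2) = SZeroBar.mk (φ c)) ∧
      (∀ c m : SZeroBar R₁ × SZeroBar R₂, SZeroBar.Rel c.1 m.1 → SZeroBar.Rel c.2 m.2 →
        SZeroBar.Rel (φbar c) (φbar m)) := by
  refine ⟨OuterTensor.sZeroMap hf₁ hf₂, OuterTensor.picHom D R₁ R₂,
    OuterTensor.sZeroBarMap hf₁ hf₂, fun C₁ C₂ _ _ _ _ _ _ _ _ h₁ h₂ =>
      ⟨_, OuterTensor.sZeroMap_mk hf₁ hf₂ C₁ C₂ h₁ h₂⟩,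
    OuterTensor.sZeroMap_rel hf₁ hf₂, OuterTensor.sZeroMap_ofPic hf₁ hf₂, ?_,
    OuterTensor.sZeroMap_smul hf₁ hf₂, OuterTensor.sZeroBarMap_mk hf₁ hf₂,
    OuterTensor.sZeroBarMap_rel hf₁ hf₂⟩
  intro A₁ A₂ _ _ _ _ _ _ _ _ _ _
  have h := OuterTensor.invertible D R₁ R₂ A₁ A₂
  have h₁ := OuterTensor.invertible D R₁ R₂ A₁ R₂
  have h₂ := OuterTensor.invertible D R₁ R₂ R₁ A₂
  exact ⟨h, h₁, h₂, OuterTensor.picHom_mk D R₁ R₂ A₁ A₂,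
    OuterTensor.picMk_eq_baseChange_mul D R₁ R₂ A₁ A₂, OuterTensor.picMk_eq_mul D R₁ R₂ A₁ A₂⟩
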